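/- All functions are real-valued on $\mathbb R$; $Q$ runs over the compact intervals of positive length, $|E|$ is Lebesgue measure, and $\langle f\rangle_Q=\frac1{|Q|}\int_Q f$. For a measurable $p:\mathbb R\to[1,\infty)$ put $$\|f\|_{L^{p(\cdot)}}=\inf\Big\{\lambda>0:\int_{\mathbb R}|f(x)/\lambda|^{p(x)}\,dx\le 1\Big\},\qquad \|f\|_{X_Q}=\frac{\|f\chi_Q\|_{L^{p(\cdot)}}}{\|\chi_Q\|_{L^{p(\cdot)}}},\qquad X=L^{p(\cdot)}.$$ Let $\mathrm{BMO}_X$ be the space of locally integrable $f$ with $\|f\|_{\mathrm{BMO}_X}=\sup_Q\|f-\langle f\rangle_Q\|_{X_Q}<\infty$, let $\mathrm{BMO}_X^*$ be the space of measurable $f$ with $\|f\|_{\mathrm{BMO}^*_X}=\sup_Q\inf_{c\in\mathbb R}\|f-c\|_{X_Q}<\infty$, and let $\mathrm{BMO}$ be the space of locally integrable $f$ with $\|f\|_{\mathrm{BMO}}=\sup_Q\frac1{|Q|}\int_Q|f-\langle f\rangle_Q|<\infty$. Write $A\hookrightarrow B$ if $A\subseteq B$ and $\|f\|_B\le C\|f\|_A$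 for all $f\in A$ with a constant $C$ independent of $f$; an equality of spaces means embeddings in both directions. For $0<\delta<1$, $X$ satisfies the condition $A_\delta$ if there is $c>0$ such that $\|\chi_E\|_{X_Q}\ge c$ for all $Q$ and all measurable $E\subseteq Q$ with $|E|\ge\delta|Q|$. For $0<t<1$ let $\psi_X(t)=\sup\{\|\chi_E\|_{X_Q}: Q \text{ an interval},\ E\subseteq Q \text{ measurable},\ |E|\le t|Q|\}$. Let $Mf(x)=\sup_{Q\ni x}\langle|f|\rangle_Q$, and let $X'$ be the associate space, with norm $\|g\|_{X'}=\sup\{\int|fg|:\|f\|_{L^{p(\cdot)}}\le1\}$. **Statement.** For all $0<\varepsilon<\delta<1$ there is a bounded $C^\infty$ exponent $p:\mathbb R\to[1,\infty)$ such that, with $X=L^{p(\cdot)}$: (i) $X$ satisfies $A_\delta$ but not $A_\varepsilon$; (ii) there is $C$ such that $\psi_X(t)\le C\,t^{1/2}$ for all $t\in(0,1)$; (iii) $\mathrm{BMO}_X^*\hookrightarrow\mathrm{BMO}$; (iv) $\mathrm{BMO}=\mathrm{BMO}_X=\mathrm{BMO}_X^*$; (v) $M$ is not of restricted weak type on $X$,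 i.e. there is no $C$ with $\lambda\|\chi_{\{M\chi_E>\lambda\}}\|_{L^{p(\cdot)}}\le C\|\chi_E\|_{L^{p(\cdot)}}$ for all $\lambda>0$ and all measurable $E\subseteq\mathbb R$; and $M$ is not bounded on $X'$. Consequently none of the following is necessary for $\mathrm{BMO}=\mathrm{BMO}_X=\mathrm{BMO}_X^*$: the condition $A_\eta$ for any given $\eta\in(0,1)$ (in particular $A_{1/2}$), the restricted weak type boundedness of $M$ on $X$, the boundedness of $M$ on $X'$. Precisely, for every $\eta\in(0,1)$ there is a bounded $C^\infty$ exponent $p:\mathbb R\to[1,\infty)$ such that (iv) and (v) hold and $X=L^{p(\cdot)}$ does not satisfy $A_\eta$. -/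

import Mathlib

open scoped ENNReal NNReal
open MeasureTheory

noncomputable section

namespace VarExpBMO

/-- A cube in dimension one: a compact interval of positive length. -/
structure Cube where
  left : ℝ
  right : ℝ
  left_lt_right : left < right

/-- The set of points of a cube. -/
def Cube.set (Q : Cube) : Set ℝ := Set.Icc Q.left Q.right

/-- The characteristic function of a set. -/
def chi (E : Set ℝ) : ℝ → ℝ := E.indicator (fun _ => 1)

/-- A family `X = {X_Q}` of function spaces, given through its norms `f ↦ ‖f‖_{X_Q}`
(the value `∞` means that `f` is not in `X_Q`). -/
abbrev NormFamily : Type := Cube → (ℝ → ℝ) → ℝ≥0∞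

/-! ### Function spaces with a (semi)norm, and continuous embeddings -/

/-- A set of functions together with the functional that measures them. -/
structure FunctionSpace where
  carrier : Set (ℝ → ℝ)
  norm : (ℝ → ℝ) → ℝ≥0∞

/-- The continuous embedding of `A` into `B`. -/
def FunctionSpace.Embeds (A B : FunctionSpace) : Prop :=
  ∃ C : ℝ≥0, ∀ f ∈ A.carrier, f ∈ B.carrier ∧ B.norm f ≤ C * A.norm f

/-- `A` and `B` have the same elements and equivalent (semi)norms. -/
def FunctionSpace.Same (A B : FunctionSpace) : Prop :=
  A.carrier = B.carrier ∧ A.Embeds B ∧ B.Embeds A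

/-! ### The spaces of bounded mean oscillation -/

/-- `‖f‖_BMO`, the supremum over all `Q` of the mean of `|f - ⟨f⟩_Q|` over `Q`. -/
def bmoNorm (f : ℝ → ℝ) : ℝ≥0∞ :=
  ⨆ Q : Cube, (∫⁻ x in Q.set, ‖f x - ⨍ y in Q.set, f y‖ₑ) / volume Q.set

/-- `‖f‖_{BMO_X}`, the supremum over all `Q` of `‖f - ⟨f⟩_Q‖_{X_Q}`. -/
def bmoXNorm (X : NormFamily) (f : ℝ → ℝ) : ℝ≥0∞ :=
  ⨆ Q : Cube, X Q (fun x => f x - ⨍ y in Q.set, f y)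

/-- `‖f‖_{BMO_X^*}`, the supremum over all `Q` of `inf_c ‖f - c‖_{X_Q}`. -/
def bmoXStarNorm (X : NormFamily) (f : ℝ → ℝ) : ℝ≥0∞ :=
  ⨆ Q : Cube, ⨅ c : ℝ, X Q (fun x => f x - c)

/-- The space `BMO` of locally integrable functions of bounded mean oscillation. -/
def BMO : FunctionSpace where
  carrier := {f | LocallyIntegrable f volume ∧ bmoNorm f < ∞}
  norm := bmoNorm

/-- The space `BMO_X` (locally integrable functions). -/
def BMOX (X : NormFamily) : FunctionSpace where
  carrier := {f | LocallyIntegrable f volume ∧ bmoXNorm X f < ∞}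
  norm := bmoXNorm X

/-- The space `BMO_X^*` (measurable functions, no local integrability required). -/
def BMOXStar (X : NormFamily) : FunctionSpace where
  carrier := {f | AEMeasurable f volume ∧ bmoXStarNorm X f < ∞}
  norm := bmoXStarNorm X

/-! ### The condition `A_δ` and the function `ψ_X` -/

/-- The condition `A_δ`: `‖χ_E‖_{X_Q} ≳ 1` for all cubes `Q` and all measurable `E ⊆ Q`
with `|E| ≥ δ|Q|`. -/
def CondA (δ : ℝ) (X : NormFamily) : Prop :=
  ∃ c : ℝ≥0, 0 < c ∧ ∀ (Q : Cube) (E : Set ℝ), MeasurableSet E → E ⊆ Q.set →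
    ENNReal.ofReal δ * volume Q.set ≤ volume E → (c : ℝ≥0∞) ≤ X Q (chi E)

/-- `ψ_X(t)`, the supremum of `‖χ_E‖_{X_Q}` over all cubes `Q` and all measurable `E ⊆ Q`
with `|E| ≤ t|Q|`. -/
def psi (X : NormFamily) (t : ℝ) : ℝ≥0∞ :=
  ⨆ (Q : Cube) (E : Set ℝ) (_ : MeasurableSet E) (_ : E ⊆ Q.set)
    (_ : volume E ≤ ENNReal.ofReal t * volume Q.set), X Q (chi E)

/-! ### Variable exponent Lebesgue spaces -/

/-- The Luxemburg norm of `L^{p(·)}`. -/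
def luxNorm (p : ℝ → ℝ) (f : ℝ → ℝ) : ℝ≥0∞ :=
  ⨅ (l : ℝ≥0) (_ : 0 < l)
    (_ : ∫⁻ x, ENNReal.ofReal (|f x / (l : ℝ)| ^ p x) ≤ 1), (l : ℝ≥0∞)

/-- The normalized family `‖f‖_{X_Q} = ‖f χ_Q‖ / ‖χ_Q‖`, with norms in `L^{p(·)}`. -/
def varLp (p : ℝ → ℝ) : NormFamily := fun Q f =>
  luxNorm p (Q.set.indicator f) / luxNorm p (chi Q.set)

/-- A smooth bounded exponent `p : ℝ → [1, ∞)`. -/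
structure IsSmoothBoundedExponent (p : ℝ → ℝ) : Prop where
  smooth : ContDiff ℝ (⊤ : ℕ∞) p
  one_le : ∀ x, 1 ≤ p x
  bdd : ∃ B : ℝ, ∀ x, p x ≤ B

/-! ### The maximal operator -/

/-- The Hardy–Littlewood maximal function of `f`, the supremum of the means of `|f|` over the
cubes that contain the point. -/
def maximal (f : ℝ → ℝ) (x : ℝ) : ℝ≥0∞ :=
  ⨆ (Q : Cube) (_ : x ∈ Q.set), (∫⁻ y in Q.set, ‖f y‖ₑ) / volume Q.set

/-- `M` is of restricted weak type on `L^{p(·)}`. -/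
def MaximalRestrictedWeakType (p : ℝ → ℝ) : Prop :=
  ∃ C : ℝ≥0, ∀ E : Set ℝ, MeasurableSet E → ∀ l : ℝ≥0, 0 < l →
    (l : ℝ≥0∞) * luxNorm p (chi {x | (l : ℝ≥0∞) < maximal (chi E) x}) ≤ C * luxNorm p (chi E)

/-- The norm of the associate space of `L^{p(·)}`, on nonnegative extended functions
(to be applied to `|g|` and to `Mg`). -/
def assocNorm (p : ℝ → ℝ) (g : ℝ → ℝ≥0∞) : ℝ≥0∞ :=
  ⨆ (f : ℝ → ℝ) (_ : AEMeasurable f volume) (_ : luxNorm p f ≤ 1), ∫⁻ x, ‖f x‖ₑ * g x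

/-- `M` is bounded on the associate space of `L^{p(·)}`. -/
def MaximalBoundedOnAssociate (p : ℝ → ℝ) : Prop :=
  ∃ C : ℝ≥0, ∀ g : ℝ → ℝ, AEMeasurable g volume → assocNorm p (fun x => ‖g x‖ₑ) < ∞ →
    assocNorm p (maximal g) ≤ C * assocNorm p (fun x => ‖g x‖ₑ)

end VarExpBMO

end

namespace VarExpBMO

/-! ### Cubes -/

/-! The exponent is smooth and 1-periodic with values in `[1, 2]`: it is `2` on a proportion at
least `ε` of each period and `1` on a proportion greater than `1 - δ`. On cubes of length at most
`1` the Lipschitz bound makes `p` behave like a constant, so `‖χ_Q‖` is comparable to `|Q| ^ (1 /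
p)`. On long cubes the set `{p = 1}` has positive density and forces `‖χ_Q‖` to be comparable to
`|Q|`; `scale` records both regimes.

On a long cube, a subset of proportion `δ` must contain a fixed proportion of points with `p = 1`,
which gives `A_δ`. The part of `[0, N]` where `p = 2` has proportion at least `ε` but norm at most
`√N`, against `‖χ_[0,N]‖ ≈ N`; this refutes `A_ε`. Since the maximal function of its indicator is at
least `ε` on `[0, N]`, the same set refutes the restricted weak type. Dually, `χ_{p = 1}` lies in
`X'`, but its maximal function is bounded below on `[0, N]`, and pairing with the normalized high
part gives growth like `√N`.

`BMO` embeds into `BMO_X` because `p ≤ 2`: the modular is dominated by first and second moments, and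
the second moment comes from a John–Nirenberg argument (`lintegral_sq_sub_avg_le`).

For `BMO_X^*` into `BMO`, cubes of length at most `2R` are controlled directly, as `p ≥ 1`. On a
longer cube the norm controls `|f - m|` in `L^1` only where `p = 1`. Halving down to lengths between
`R` and `2R` gives pieces on which `f` oscillates little, so the deviation from `m` on the low part
of a piece controls the deviation on the whole piece; these bounds add up
(`lintegral_sub_le_add_low_of_le`). -/

/-- The length of a cube. -/
def Cube.len (Q : Cube) : ℝ := Q.right - Q.left

lemma Cube.len_pos (Q : Cube) : 0 < Q.len := sub_pos.2 Q.left_lt_right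

lemma Cube.volume_set (Q : Cube) : volume Q.set = ENNReal.ofReal Q.len := Real.volume_Icc

lemma Cube.measurableSet (Q : Cube) : MeasurableSet Q.set := measurableSet_Icc

lemma Cube.left_mem (Q : Cube) : Q.left ∈ Q.set := ⟨le_rfl, Q.left_lt_right.le⟩

lemma Cube.abs_sub_le (Q : Cube) {x y : ℝ} (hx : x ∈ Q.set) (hy : y ∈ Q.set) :
    |x - y| ≤ Q.len := by
  rw [abs_le, Cube.len]
  constructor <;> linarith [hx.1, hx.2, hy.1, hy.2]

/-! ### The Luxemburg norm -/

/-- The modular of `f` restricted to a set. -/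
lemma modular_indicator {p : ℝ → ℝ} (hp : ∀ x, 1 ≤ p x) {E : Set ℝ} (hE : MeasurableSet E)
    (f : ℝ → ℝ) (l : ℝ) :
    ∫⁻ x, ENNReal.ofReal (|E.indicator f x / l| ^ p x)
      = ∫⁻ x in E, ENNReal.ofReal (|f x / l| ^ p x) := by
  rw [← lintegral_indicator hE]
  refine lintegral_congr fun x => ?_
  by_cases hx : x ∈ E
  · simp [hx]
  · have : p x ≠ 0 := by linarith [hp x]
    simp [hx, Real.zero_rpow this]

lemma modular_chi {p : ℝ → ℝ} (hp : ∀ x, 1 ≤ p x) {E : Set ℝ} (hE : MeasurableSet E)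
    {l : ℝ} (hl : 0 < l) :
    ∫⁻ x, ENNReal.ofReal (|chi E x / l| ^ p x)
      = ∫⁻ x in E, ENNReal.ofReal (l⁻¹ ^ p x) := by
  rw [chi, modular_indicator hp hE]
  simp [abs_of_pos hl]

lemma luxNorm_le {p f : ℝ → ℝ} {l : ℝ} (hl : 0 < l)
    (h : ∫⁻ x, ENNReal.ofReal (|f x / l| ^ p x) ≤ 1) : luxNorm p f ≤ ENNReal.ofReal l := by
  lift l to ℝ≥0 using hl.le
  rw [ENNReal.ofReal_coe_nnreal]
  exact iInf_le_of_le l (iInf_le_of_le (by exact_mod_cast hl) (iInf_le_of_le h le_rfl))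

lemma le_luxNorm {p f : ℝ → ℝ} {a : ℝ}
    (h : ∀ l : ℝ, 0 < l → ∫⁻ x, ENNReal.ofReal (|f x / l| ^ p x) ≤ 1 → a ≤ l) :
    ENNReal.ofReal a ≤ luxNorm p f := by
  refine le_iInf fun l => le_iInf fun hl => le_iInf fun hm => ?_
  rw [← ENNReal.ofReal_coe_nnreal]
  exact ENNReal.ofReal_le_ofReal (h l (by exact_mod_cast hl) hm)

lemma modular_mono {p f g : ℝ → ℝ} (hp : ∀ x, 1 ≤ p x) {l m : ℝ} (hl : 0 < l) (hlm : l ≤ m)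
    (hfg : ∀ x, |g x| ≤ |f x|) (x : ℝ) :
    ENNReal.ofReal (|g x / m| ^ p x) ≤ ENNReal.ofReal (|f x / l| ^ p x) := by
  refine ENNReal.ofReal_le_ofReal (Real.rpow_le_rpow (abs_nonneg _) ?_ (by linarith [hp x]))
  rw [abs_div, abs_div, abs_of_pos hl, abs_of_pos (hl.trans_le hlm)]
  exact div_le_div₀ (abs_nonneg _) (hfg x) hl hlm

lemma modular_le_one_of_luxNorm_lt {p f : ℝ → ℝ} (hp : ∀ x, 1 ≤ p x) {a : ℝ}
    (h : luxNorm p f < ENNReal.ofReal a) : ∫⁻ x, ENNReal.ofReal (|f x / a| ^ p x) ≤ 1 := by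
  simp only [luxNorm, iInf_lt_iff] at h
  obtain ⟨l, hl, hm, hla⟩ := h
  rw [← ENNReal.ofReal_coe_nnreal] at hla
  have hla' : (l : ℝ) ≤ a := (ENNReal.ofReal_lt_ofReal_iff'.1 hla).1.le
  exact (lintegral_mono fun x =>
    modular_mono hp (by exact_mod_cast hl) hla' (fun _ => le_rfl) x).trans hm

lemma luxNorm_mono {p f g : ℝ → ℝ} (hp : ∀ x, 1 ≤ p x) (hfg : ∀ x, |g x| ≤ |f x|) :
    luxNorm p g ≤ luxNorm p f := by
  refine le_iInf fun l => le_iInf fun hl => le_iInf fun hm => ?_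
  rw [← ENNReal.ofReal_coe_nnreal]
  exact luxNorm_le (by exact_mod_cast hl) ((lintegral_mono fun x =>
    modular_mono hp (by exact_mod_cast hl) le_rfl hfg x).trans hm)

lemma luxNorm_chi_mono {p : ℝ → ℝ} (hp : ∀ x, 1 ≤ p x) {E F : Set ℝ} (h : E ⊆ F) :
    luxNorm p (chi E) ≤ luxNorm p (chi F) := by
  refine luxNorm_mono hp fun x => ?_
  by_cases hx : x ∈ E
  · simp [chi, hx, h hx]
  · simp [chi, hx]

/-! ### Exponents oscillating between one and two -/

/-- An exponent with values in `[1, 2]` and Lipschitz constant `H` that takes the value `2` on a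
proportion at least `ε` of the intervals `[0, N]`, and the value `1` on a proportion greater than
`1 - δ` of every long interval. -/
structure OscillatingExponent (p : ℝ → ℝ) (ε δ H R c : ℝ) : Prop where
  cont : Continuous p
  one_le : ∀ x, 1 ≤ p x
  le_two : ∀ x, p x ≤ 2
  lip : ∀ x y, |p x - p y| ≤ H * |x - y|
  H_nonneg : 0 ≤ H
  one_le_R : 1 ≤ R
  c_pos : 0 < c
  ε_pos : 0 < ε
  c_lt : c < δ
  δ_lt : δ < 1
  high : ∀ N : ℕ, ENNReal.ofReal (ε * N) ≤ volume (Set.Icc 0 (N : ℝ) ∩ {x | p x = 2})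
  low : ∀ Q : Cube, R ≤ Q.len →
    volume (Q.set \ {x | p x = 1}) ≤ ENNReal.ofReal ((δ - c) * Q.len)

/-- A number comparable to `‖χ_Q‖`. -/
noncomputable def scale (p : ℝ → ℝ) (Q : Cube) : ℝ :=
  if Q.len ≤ 1 then Q.len ^ (1 / p Q.left) else Q.len

lemma scale_pos (p : ℝ → ℝ) (Q : Cube) : 0 < scale p Q := by
  unfold scale
  split_ifs
  · exact Real.rpow_pos_of_pos Q.len_pos _
  · exact Q.len_pos

/-! ### Norms of characteristic functions compared with `scale` -/

namespace OscillatingExponent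

variable {p : ℝ → ℝ} {ε δ H R c : ℝ}

lemma δ_pos (h : OscillatingExponent p ε δ H R c) : 0 < δ := h.c_pos.trans h.c_lt

lemma measurable (h : OscillatingExponent p ε δ H R c) : Measurable p := h.cont.measurable

lemma measurableSet_low (h : OscillatingExponent p ε δ H R c) : MeasurableSet {x | p x = 1} :=
  measurableSet_eq_fun h.measurable measurable_const

lemma measurableSet_high (h : OscillatingExponent p ε δ H R c) : MeasurableSet {x | p x = 2} :=
  measurableSet_eq_fun h.measurable measurable_const

/-- On small cubes the powers `|Q| ^ (p x / p y)` are comparable to `|Q|`. -/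
lemma rpow_scale_of_len_le_one (h : OscillatingExponent p ε δ H R c) {Q : Cube} (hQ : Q.len ≤ 1)
    {x : ℝ} (hx : x ∈ Q.set) :
    Real.exp (-H) * Q.len ≤ scale p Q ^ p x ∧ scale p Q ^ p x ≤ Real.exp H * Q.len := by
  have hL := Q.len_pos
  have hp := h.one_le Q.left
  have hp0 : 0 < p Q.left := by linarith
  have hlog : Real.log Q.len ≤ 0 := Real.log_nonpos hL.le hQ
  set L := Q.len
  have hs : scale p Q ^ p x = Real.exp (Real.log L * ((p x - p Q.left) / p Q.left)) * L := by
    have : scale p Q = L ^ (1 / p Q.left) := if_pos hQ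
    rw [this, ← Real.rpow_mul hL.le]
    nth_rw 3 [← Real.exp_log hL]
    rw [← Real.exp_add, Real.rpow_def_of_pos hL]
    congr 1
    field_simp
    ring
  have hlip : |(p x - p Q.left) / p Q.left| ≤ H * L := by
    rw [abs_div, abs_of_pos hp0]
    refine (div_le_self (abs_nonneg _) hp).trans ((h.lip _ _).trans ?_)
    exact mul_le_mul_of_nonneg_left (Q.abs_sub_le hx Q.left_mem) h.H_nonneg
  -- This is the log-Hölder effect: the exponent varies by at most `H * L` on `Q`, and `L * |log L|`
  -- stays bounded, so the error factor lies between `exp (-H)` and `exp H`.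
  have hLlog : -Real.log L * L ≤ 1 := by
    have := Real.one_sub_inv_le_log_of_pos hL
    have h2 : -Real.log L * L ≤ (L⁻¹ - 1) * L := by gcongr; linarith
    rw [sub_mul, inv_mul_cancel₀ hL.ne'] at h2
    linarith
  have habs : |Real.log L * ((p x - p Q.left) / p Q.left)| ≤ H := by
    rw [abs_mul, abs_of_nonpos hlog]
    calc -Real.log L * |(p x - p Q.left) / p Q.left| ≤ -Real.log L * (H * L) := by
          gcongr; linarith
      _ = H * (-Real.log L * L) := by ring
      _ ≤ H * 1 := by gcongr; exact h.H_nonneg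
      _ = H := mul_one H
  rw [abs_le] at habs
  rw [hs]
  constructor <;> gcongr <;> tauto

lemma len_le_rpow_scale (h : OscillatingExponent p ε δ H R c) {Q : Cube}
    {x : ℝ} (hx : x ∈ Q.set) : Real.exp (-H) * Q.len ≤ scale p Q ^ p x := by
  by_cases hQ : Q.len ≤ 1
  · exact (h.rpow_scale_of_len_le_one hQ hx).1
  · have h1 : Q.len ≤ Q.len ^ p x := by
      simpa using Real.rpow_le_rpow_of_exponent_le (not_le.1 hQ).le (h.one_le x)
    rw [scale, if_neg hQ]
    refine le_trans ?_ h1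
    have : Real.exp (-H) ≤ 1 := Real.exp_le_one_iff.2 (by linarith [h.H_nonneg])
    nlinarith [Q.len_pos]

/-- Unlike the lower bound, this one cannot be uniform in the length: for `1 < L ≤ T` only `L ^ p ≤
L ^ 2 ≤ T * L` is available, whence the factor `T`. -/
lemma rpow_scale_le (h : OscillatingExponent p ε δ H R c) {Q : Cube} {T : ℝ} (hT : 1 ≤ T)
    (hQ : Q.len ≤ T) {x : ℝ} (hx : x ∈ Q.set) :
    scale p Q ^ p x ≤ Real.exp H * T * Q.len := by
  have hH : 1 ≤ Real.exp H := Real.one_le_exp h.H_nonneg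
  by_cases hQ1 : Q.len ≤ 1
  · refine (h.rpow_scale_of_len_le_one hQ1 hx).2.trans ?_
    have := mul_pos (Real.exp_pos H) Q.len_pos
    nlinarith
  · have h1 : Q.len ^ p x ≤ Q.len ^ (2 : ℝ) :=
      Real.rpow_le_rpow_of_exponent_le (not_le.1 hQ1).le (h.le_two x)
    rw [scale, if_neg hQ1]
    refine h1.trans ?_
    rw [Real.rpow_two, sq]
    have := Q.len_pos
    gcongr
    nlinarith

/-- Points of `Q` with `p ≠ 1` fill at most the proportion `δ - c`, so a set of proportion `δ` has
at least the proportion `c` left over. -/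
lemma le_volume_low (h : OscillatingExponent p ε δ H R c) {Q : Cube} (hQ : R ≤ Q.len)
    {E : Set ℝ} (hE : E ⊆ Q.set) (hEv : ENNReal.ofReal δ * volume Q.set ≤ volume E) :
    ENNReal.ofReal (c * Q.len) ≤ volume (E ∩ {x | p x = 1}) := by
  have h1 : volume E ≤ volume (E ∩ {x | p x = 1}) + volume (Q.set \ {x | p x = 1}) := by
    refine (measure_le_inter_add_sdiff _ E {x | p x = 1}).trans ?_
    gcongr
  have h2 := h.low Q hQ
  have hL := Q.len_pos
  rw [Q.volume_set, ← ENNReal.ofReal_mul h.δ_pos.le] at hEv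
  have h3 : ENNReal.ofReal (c * Q.len) + ENNReal.ofReal ((δ - c) * Q.len)
      ≤ volume (E ∩ {x | p x = 1}) + ENNReal.ofReal ((δ - c) * Q.len) := by
    rw [← ENNReal.ofReal_add (by have := h.c_pos; positivity)
      (mul_nonneg (by linarith [h.c_lt]) hL.le)]
    calc ENNReal.ofReal (c * Q.len + (δ - c) * Q.len) = ENNReal.ofReal (δ * Q.len) := by
          congr 1; ring
      _ ≤ _ := hEv.trans (h1.trans (by gcongr))
  exact (ENNReal.add_le_add_iff_right ENNReal.ofReal_ne_top).1 h3

/-- The power `1 / 2` is the reciprocal of the largest exponent: `t ^ (p x / 2) ≥ t` for `t ≤ 1`.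
The case `t = 1` bounds `‖χ_Q‖`; general `t` bounds `ψ_X`. -/
lemma luxNorm_chi_le (h : OscillatingExponent p ε δ H R c) {Q : Cube} {E : Set ℝ}
    (hEm : MeasurableSet E) (hE : E ⊆ Q.set) {t : ℝ} (ht : 0 < t) (ht1 : t ≤ 1)
    (hEv : volume E ≤ ENNReal.ofReal t * volume Q.set) :
    luxNorm p (chi E) ≤ ENNReal.ofReal (Real.exp H * (t ^ (1 / 2 : ℝ) * scale p Q)) := by
  have hs := scale_pos p Q
  have hr : 0 < t ^ (1 / 2 : ℝ) := Real.rpow_pos_of_pos ht _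
  have hH : 1 ≤ Real.exp H := Real.one_le_exp h.H_nonneg
  have hL := Q.len_pos
  refine luxNorm_le (by positivity) ?_
  rw [modular_chi h.one_le hEm (by positivity)]
  have hb : ∀ x ∈ E, (Real.exp H * (t ^ (1 / 2 : ℝ) * scale p Q))⁻¹ ^ p x ≤ (t * Q.len)⁻¹ := by
    intro x hx
    rw [Real.inv_rpow (by positivity), Real.mul_rpow (by positivity) (by positivity),
      Real.mul_rpow (by positivity) (by positivity)]
    refine inv_anti₀ (by positivity) ?_
    have e1 : Real.exp H ≤ Real.exp H ^ p x := by
      simpa using Real.rpow_le_rpow_of_exponent_le hH (h.one_le x)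
    have e2 : t ≤ (t ^ (1 / 2 : ℝ)) ^ p x := by
      rw [← Real.rpow_mul ht.le]
      simpa using Real.rpow_le_rpow_of_exponent_ge ht ht1
        (show 1 / 2 * p x ≤ 1 by linarith [h.le_two x])
    have e3 := h.len_le_rpow_scale (hE hx)
    calc t * Q.len = Real.exp H * (t * (Real.exp (-H) * Q.len)) := by
          rw [Real.exp_neg]; field_simp
      _ ≤ _ := by gcongr
  calc ∫⁻ x in E, ENNReal.ofReal ((Real.exp H * (t ^ (1 / 2 : ℝ) * scale p Q))⁻¹ ^ p x)
      ≤ ∫⁻ x in E, ENNReal.ofReal ((t * Q.len)⁻¹) :=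
        setLIntegral_mono measurable_const fun x hx => ENNReal.ofReal_le_ofReal (hb x hx)
    _ = ENNReal.ofReal ((t * Q.len)⁻¹) * volume E := by simp
    _ ≤ ENNReal.ofReal ((t * Q.len)⁻¹) * (ENNReal.ofReal t * volume Q.set) := by gcongr
    _ = 1 := by
        rw [Q.volume_set, ← ENNReal.ofReal_mul ht.le, ← ENNReal.ofReal_mul (by positivity),
          inv_mul_cancel₀ (by positivity), ENNReal.ofReal_one]

lemma luxNorm_chi_set_le (h : OscillatingExponent p ε δ H R c) (Q : Cube) :
    luxNorm p (chi Q.set) ≤ ENNReal.ofReal (Real.exp H * scale p Q) := by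
  simpa using h.luxNorm_chi_le Q.measurableSet subset_rfl one_pos le_rfl (by simp)

lemma R_pos (h : OscillatingExponent p ε δ H R c) : 0 < R := one_pos.trans_le h.one_le_R

lemma scale_le_luxNorm_chi (h : OscillatingExponent p ε δ H R c) {Q : Cube} {E : Set ℝ}
    (hEm : MeasurableSet E) (hE : E ⊆ Q.set)
    (hEv : ENNReal.ofReal δ * volume Q.set ≤ volume E) :
    ENNReal.ofReal (c / (Real.exp H * R) * scale p Q) ≤ luxNorm p (chi E) := by
  have hs := scale_pos p Q
  have hH : 1 ≤ Real.exp H := Real.one_le_exp h.H_nonneg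
  have hL := Q.len_pos
  have hR := h.R_pos
  have hc := h.c_pos
  have hden : 1 ≤ Real.exp H * R := one_le_mul_of_one_le_of_one_le hH h.one_le_R
  have hcd : c / (Real.exp H * R) ≤ c := div_le_self hc.le hden
  refine le_luxNorm fun l hl hm => ?_
  rw [modular_chi h.one_le hEm hl] at hm
  by_cases hQ : Q.len ≤ R
  -- On a short cube, a value `l` below the claimed bound would make the modular at least `δ / c`,
  -- which exceeds `1`.
  · by_contra! hlt
    set τ := c / (Real.exp H * R)
    have hτ : 0 < τ := by positivity
    have hτ1 : τ ≤ 1 := hcd.trans (h.c_lt.trans h.δ_lt).le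
    have hb : ∀ x ∈ E, (τ * (Real.exp H * R * Q.len))⁻¹ ≤ l⁻¹ ^ p x := by
      intro x hx
      rw [Real.inv_rpow hl.le]
      refine inv_anti₀ (by positivity) ?_
      have hp := h.one_le x
      calc l ^ p x ≤ (τ * scale p Q) ^ p x := by gcongr
        _ = τ ^ p x * scale p Q ^ p x := Real.mul_rpow hτ.le hs.le
        _ ≤ τ * (Real.exp H * R * Q.len) := by
            gcongr
            · simpa using Real.rpow_le_rpow_of_exponent_ge hτ hτ1 hp
            · exact h.rpow_scale_le h.one_le_R hQ (hE hx)
    have h1 : ENNReal.ofReal ((τ * (Real.exp H * R * Q.len))⁻¹) * ENNReal.ofReal (δ * Q.len) ≤ 1 :=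
      calc _ ≤ ENNReal.ofReal ((τ * (Real.exp H * R * Q.len))⁻¹) * volume E := by
            gcongr
            rwa [Q.volume_set, ← ENNReal.ofReal_mul h.δ_pos.le] at hEv
        _ = ∫⁻ x in E, ENNReal.ofReal ((τ * (Real.exp H * R * Q.len))⁻¹) := by simp
        _ ≤ ∫⁻ x in E, ENNReal.ofReal (l⁻¹ ^ p x) :=
            setLIntegral_mono' hEm fun x hx => ENNReal.ofReal_le_ofReal (hb x hx)
        _ ≤ 1 := hm
    rw [← ENNReal.ofReal_mul (by positivity), ENNReal.ofReal_le_one] at h1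
    have h2 : τ * (Real.exp H * R * Q.len) = c * Q.len := by simp only [τ]; field_simp
    rw [h2, inv_mul_le_iff₀ (by positivity)] at h1
    nlinarith [h.c_lt]
  -- On a long cube only the points with `p = 1` are kept; there the modular is linear in `l⁻¹`.
  · push Not at hQ
    have h1 : ENNReal.ofReal (l⁻¹ * (c * Q.len)) ≤ 1 :=
      calc _ = ENNReal.ofReal l⁻¹ * ENNReal.ofReal (c * Q.len) := ENNReal.ofReal_mul (by positivity)
        _ ≤ ENNReal.ofReal l⁻¹ * volume (E ∩ {x | p x = 1}) := by
            gcongr; exact h.le_volume_low hQ.le hE hEv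
        _ = ∫⁻ x in E ∩ {x | p x = 1}, ENNReal.ofReal l⁻¹ := by simp
        _ = ∫⁻ x in E ∩ {x | p x = 1}, ENNReal.ofReal (l⁻¹ ^ p x) :=
            setLIntegral_congr_fun (hEm.inter h.measurableSet_low) fun x hx => by
              have : p x = 1 := hx.2
              simp [this]
        _ ≤ ∫⁻ x in E, ENNReal.ofReal (l⁻¹ ^ p x) := lintegral_mono_set Set.inter_subset_left
        _ ≤ 1 := hm
    rw [ENNReal.ofReal_le_one, inv_mul_le_iff₀ hl, mul_one] at h1
    have h3 : scale p Q = Q.len := if_neg (not_le.2 (h.one_le_R.trans_lt hQ))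
    rw [h3]
    refine le_trans ?_ h1
    gcongr

lemma scale_le_luxNorm_chi_set (h : OscillatingExponent p ε δ H R c) (Q : Cube) :
    ENNReal.ofReal (c / (Real.exp H * R) * scale p Q) ≤ luxNorm p (chi Q.set) :=
  h.scale_le_luxNorm_chi Q.measurableSet subset_rfl (by
    calc ENNReal.ofReal δ * volume Q.set ≤ 1 * volume Q.set := by
          gcongr; exact ENNReal.ofReal_le_one.2 h.δ_lt.le
      _ = _ := one_mul _)

end OscillatingExponent

/-! ### Halving cubes -/

/-- The left half of a cube. -/
@[simps] noncomputable def Cube.lower (Q : Cube) : Cube where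
  left := Q.left
  right := (Q.left + Q.right) / 2
  left_lt_right := by linarith [Q.left_lt_right]

/-- The right half of a cube. -/
@[simps] noncomputable def Cube.upper (Q : Cube) : Cube where
  left := (Q.left + Q.right) / 2
  right := Q.right
  left_lt_right := by linarith [Q.left_lt_right]

lemma Cube.lower_len (Q : Cube) : Q.lower.len = Q.len / 2 := by simp [Cube.len]; ring

lemma Cube.upper_len (Q : Cube) : Q.upper.len = Q.len / 2 := by simp [Cube.len]; ring

lemma Cube.lower_subset (Q : Cube) : Q.lower.set ⊆ Q.set :=
  Set.Icc_subset_Icc_right (by simp; linarith [Q.left_lt_right])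

lemma Cube.upper_subset (Q : Cube) : Q.upper.set ⊆ Q.set :=
  Set.Icc_subset_Icc_left (by simp; linarith [Q.left_lt_right])

lemma Cube.setLIntegral_split (Q : Cube) (F : ℝ → ℝ≥0∞) :
    ∫⁻ x in Q.set, F x = (∫⁻ x in Q.lower.set, F x) + ∫⁻ x in Q.upper.set, F x := by
  have e : ∀ P : Cube, ∫⁻ x in P.set, F x = ∫⁻ x in Set.Ioc P.left P.right, F x :=
    fun P => setLIntegral_congr Ioc_ae_eq_Icc.symm
  rw [e, e, e, ← lintegral_union measurableSet_Ioc]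
  · rw [Cube.lower_left, Cube.lower_right, Cube.upper_left, Cube.upper_right,
      Set.Ioc_union_Ioc_eq_Ioc] <;> linarith [Q.left_lt_right]
  · exact Set.disjoint_left.2 fun x hx hy => absurd hx.2 (not_le.2 hy.1)

lemma Cube.set_eq_closedBall (Q : Cube) :
    Q.set = Metric.closedBall ((Q.left + Q.right) / 2) (Q.len / 2) := by
  rw [Real.closedBall_eq_Icc, Cube.set, Cube.len]
  congr 1 <;> ring

/-! ### Averages -/

/-- The mean of `f` over `Q`. -/
noncomputable def avg (f : ℝ → ℝ) (Q : Cube) : ℝ := ⨍ y in Q.set, f y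

lemma integrableOn_cube {f : ℝ → ℝ} (hf : LocallyIntegrable f volume) (Q : Cube) :
    IntegrableOn f Q.set volume := hf.integrableOn_isCompact isCompact_Icc

lemma abs_avg_sub_le {f : ℝ → ℝ} (hf : LocallyIntegrable f volume) (Q : Cube) (c : ℝ) :
    ENNReal.ofReal (|avg f Q - c| * Q.len) ≤ ∫⁻ x in Q.set, ‖f x - c‖ₑ := by
  have hL := Q.len_pos
  have hv : volume.real Q.set = Q.len := by
    rw [Measure.real, Q.volume_set, ENNReal.toReal_ofReal hL.le]
  have hi : ∫ x in Q.set, (f x - c) = (avg f Q - c) * Q.len := by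
    rw [integral_sub (integrableOn_cube hf Q) (integrableOn_const (by simp [Q.volume_set])),
      avg, setAverage_eq, setIntegral_const, hv]
    simp only [smul_eq_mul]
    field_simp
  have := enorm_integral_le_lintegral_enorm (μ := volume.restrict Q.set) (fun x => f x - c)
  rwa [hi, Real.enorm_eq_ofReal_abs, abs_mul, abs_of_pos hL] at this

/-- The mean of `f` over the interval of the `n`-th dyadic generation of `Q` that contains `x`. -/
noncomputable def dyadicAvg (f : ℝ → ℝ) : ℕ → Cube → ℝ → ℝ
  | 0, Q, _ => avg f Q
  | n + 1, Q, x => if x ≤ (Q.left + Q.right) / 2 then dyadicAvg f n Q.lower x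
      else dyadicAvg f n Q.upper x

lemma measurable_dyadicAvg (f : ℝ → ℝ) (n : ℕ) (Q : Cube) : Measurable (dyadicAvg f n Q) := by
  induction n generalizing Q with
  | zero => exact measurable_const
  | succ n ih => exact Measurable.ite measurableSet_Iic (ih _) (ih _)

/-- Closed balls containing `x`, not necessarily centred at it, are the form in which the Lebesgue
differentiation theorem for doubling measures applies. -/
lemma dyadicAvg_eq (f : ℝ → ℝ) (n : ℕ) (Q : Cube) {x : ℝ} (hx : x ∈ Q.set) :
    ∃ m : ℝ, x ∈ Metric.closedBall m (Q.len / 2 / 2 ^ n) ∧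
      dyadicAvg f n Q x = ⨍ y in Metric.closedBall m (Q.len / 2 / 2 ^ n), f y := by
  induction n generalizing Q with
  | zero =>
    refine ⟨(Q.left + Q.right) / 2, ?_, ?_⟩ <;> rw [pow_zero, div_one, ← Q.set_eq_closedBall]
    · exact hx
    · rfl
  | succ n ih =>
    have hlen : Q.len / 2 / 2 ^ (n + 1) = Q.len / 2 / 2 / 2 ^ n := by rw [pow_succ]; field_simp
    rw [hlen, dyadicAvg]
    split_ifs with h
    · rw [← Q.lower_len]
      exact ih Q.lower ⟨hx.1, h⟩
    · rw [← Q.upper_len]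
      exact ih Q.upper ⟨(not_le.1 h).le, hx.2⟩

lemma ae_tendsto_dyadicAvg {f : ℝ → ℝ} (hf : LocallyIntegrable f volume) (Q : Cube) :
    ∀ᵐ x ∂(volume.restrict Q.set),
      Filter.Tendsto (fun n => dyadicAvg f n Q x) Filter.atTop (nhds (f x)) := by
  rw [ae_restrict_iff' Q.measurableSet]
  filter_upwards [IsUnifLocDoublingMeasure.ae_tendsto_average volume hf 1] with x hx hxQ
  choose m hm he using fun n => dyadicAvg_eq f n Q hxQ
  simp_rw [he]
  have hL := Q.len_pos
  refine hx m _ (tendsto_nhdsWithin_iff.2 ⟨?_, ?_⟩) ?_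
  · have := (tendsto_pow_atTop_nhds_zero_of_lt_one (r := (1 / 2 : ℝ)) (by norm_num)
      (by norm_num)).const_mul (Q.len / 2)
    simpa [div_eq_mul_inv] using this
  · exact Filter.Eventually.of_forall fun n => by simp only [Set.mem_Ioi]; positivity
  · exact Filter.Eventually.of_forall fun n => by simpa using hm n

/-! ### The John–Nirenberg inequality for the second moment -/

/-- The second moment of the dyadic means of `f` about `c`. -/
noncomputable def dyadicMoment (f : ℝ → ℝ) (n : ℕ) (Q : Cube) (c : ℝ) : ℝ≥0∞ :=
  ∫⁻ x in Q.set, ENNReal.ofReal ((dyadicAvg f n Q x - c) ^ 2)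

lemma dyadicMoment_zero (f : ℝ → ℝ) (Q : Cube) (c : ℝ) :
    dyadicMoment f 0 Q c = ENNReal.ofReal ((avg f Q - c) ^ 2 * Q.len) := by
  simp [dyadicMoment, dyadicAvg, Q.volume_set, ENNReal.ofReal_mul (sq_nonneg _)]

lemma dyadicMoment_succ (f : ℝ → ℝ) (n : ℕ) (Q : Cube) (c : ℝ) :
    dyadicMoment f (n + 1) Q c = dyadicMoment f n Q.lower c + dyadicMoment f n Q.upper c := by
  rw [dyadicMoment, Q.setLIntegral_split]
  congr 1
  · refine setLIntegral_congr_fun Q.lower.measurableSet fun x hx => ?_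
    have : x ≤ (Q.left + Q.right) / 2 := hx.2
    simp [dyadicAvg, this]
  · refine setLIntegral_congr_fun_ae Q.upper.measurableSet ?_
    have h0 : ∀ᵐ x : ℝ, x ≠ (Q.left + Q.right) / 2 := by simp [ae_iff]
    filter_upwards [h0] with x hx0 hx
    have : ¬ x ≤ (Q.left + Q.right) / 2 := fun h => hx0 (le_antisymm h hx.1)
    simp [dyadicAvg, this]

lemma dyadicMoment_le (f : ℝ → ℝ) (n : ℕ) (Q : Cube) (c d : ℝ) :
    dyadicMoment f n Q c
      ≤ ENNReal.ofReal 2 * dyadicMoment f n Q d + ENNReal.ofReal (2 * (d - c) ^ 2 * Q.len) := by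
  have hm : Measurable fun x => ENNReal.ofReal ((dyadicAvg f n Q x - d) ^ 2) :=
    (((measurable_dyadicAvg f n Q).sub_const d).pow_const 2).ennreal_ofReal
  calc dyadicMoment f n Q c
      ≤ ∫⁻ x in Q.set, (ENNReal.ofReal 2 * ENNReal.ofReal ((dyadicAvg f n Q x - d) ^ 2)
          + ENNReal.ofReal (2 * (d - c) ^ 2)) := by
        refine lintegral_mono fun x => ?_
        rw [← ENNReal.ofReal_mul (by norm_num), ← ENNReal.ofReal_add (by positivity) (by positivity)]
        refine ENNReal.ofReal_le_ofReal ?_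
        nlinarith [sq_nonneg (dyadicAvg f n Q x - d - (d - c))]
    _ = _ := by
        rw [lintegral_add_right _ measurable_const, lintegral_const_mul _ hm, setLIntegral_const,
          Q.volume_set, ← ENNReal.ofReal_mul (by positivity), dyadicMoment]

section JohnNirenberg

variable {f : ℝ → ℝ} {b : ℝ}

/-- A half inherits at most the whole oscillation integral `b * |Q|` while its measure is `|Q| / 2`.
-/
lemma abs_avg_half_sub_le (hf : LocallyIntegrable f volume)
    (hosc : ∀ Q : Cube, ∫⁻ x in Q.set, ‖f x - avg f Q‖ₑ ≤ ENNReal.ofReal (b * Q.len))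
    (hb : 0 ≤ b) {Q P : Cube} (hP : P.set ⊆ Q.set) (hlen : P.len = Q.len / 2) :
    |avg f P - avg f Q| ≤ 2 * b := by
  have h1 := (abs_avg_sub_le hf P (avg f Q)).trans ((lintegral_mono_set hP).trans (hosc Q))
  have hL := Q.len_pos
  rw [ENNReal.ofReal_le_ofReal_iff (by positivity), hlen] at h1
  nlinarith

/-- One step of the stopping time argument: the bound for the moments about the mean gives a bound
for the moments about any close point. -/
lemma dyadicMoment_le_of_close (hf : LocallyIntegrable f volume)
    (hosc : ∀ Q : Cube, ∫⁻ x in Q.set, ‖f x - avg f Q‖ₑ ≤ ENNReal.ofReal (b * Q.len))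
    (hb : 0 ≤ b) (n : ℕ)
    (hmean : ∀ Q : Cube, dyadicMoment f n Q (avg f Q) ≤ ENNReal.ofReal (68 * b ^ 2 * Q.len))
    (hprev : ∀ k, n = k + 1 → ∀ (Q : Cube) (c : ℝ), |avg f Q - c| ≤ 6 * b →
      dyadicMoment f k Q c
        ≤ ENNReal.ofReal (16 * b ^ 2 * Q.len) + ENNReal.ofReal (52 * b) * ∫⁻ x in Q.set, ‖f x - c‖ₑ)
    (Q : Cube) (c : ℝ) (hc : |avg f Q - c| ≤ 6 * b) :
    dyadicMoment f n Q c
      ≤ ENNReal.ofReal (16 * b ^ 2 * Q.len)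
        + ENNReal.ofReal (52 * b) * ∫⁻ x in Q.set, ‖f x - c‖ₑ := by
  have hL := Q.len_pos
  -- The threshold `4b` leaves room for one halving: the means of the halves move by at most `2b`
  -- and stay within `6b` of `c`. Beyond `4b` the process stops.
  by_cases hc4 : |avg f Q - c| ≤ 4 * b
  · cases n with
    | zero =>
      rw [dyadicMoment_zero]
      refine le_trans (ENNReal.ofReal_le_ofReal ?_) le_self_add
      have : (avg f Q - c) ^ 2 ≤ (4 * b) ^ 2 := sq_le_sq' (by linarith [abs_le.1 hc4])
        (by linarith [abs_le.1 hc4])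
      nlinarith
    | succ k =>
      have hl := abs_avg_half_sub_le hf hosc hb Q.lower_subset Q.lower_len
      have hu := abs_avg_half_sub_le hf hosc hb Q.upper_subset Q.upper_len
      have h1 := hprev k rfl Q.lower c ((abs_sub_le _ (avg f Q) _).trans (by linarith))
      have h2 := hprev k rfl Q.upper c ((abs_sub_le _ (avg f Q) _).trans (by linarith))
      rw [dyadicMoment_succ, Q.setLIntegral_split, mul_add]
      refine (add_le_add h1 h2).trans (le_of_eq ?_)
      rw [Q.lower_len, Q.upper_len, add_add_add_comm, ← ENNReal.ofReal_add (by positivity)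
        (by positivity)]
      congr 2
      ring
  · push Not at hc4
    have hsq : (avg f Q - c) ^ 2 ≤ (6 * b) ^ 2 := sq_le_sq' (by linarith [abs_le.1 hc])
        (by linarith [abs_le.1 hc])
    calc dyadicMoment f n Q c
        ≤ ENNReal.ofReal 2 * dyadicMoment f n Q (avg f Q)
          + ENNReal.ofReal (2 * (avg f Q - c) ^ 2 * Q.len) := dyadicMoment_le f n Q c _
      _ ≤ ENNReal.ofReal 2 * ENNReal.ofReal (68 * b ^ 2 * Q.len)
          + ENNReal.ofReal (2 * (6 * b) ^ 2 * Q.len) := by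
          gcongr
          exact hmean Q
      -- Here `2 * 68 + 2 * 36 = 52 * 4`. The stopped cube pays for its moment, since `∫ |f - c|`
      -- over it is at least `4b * |Q|`.
      _ = ENNReal.ofReal (52 * b) * ENNReal.ofReal (4 * b * Q.len) := by
          rw [← ENNReal.ofReal_mul (by positivity), ← ENNReal.ofReal_mul (by positivity),
            ← ENNReal.ofReal_add (by positivity) (by positivity)]
          congr 1
          ring
      _ ≤ ENNReal.ofReal (52 * b) * ∫⁻ x in Q.set, ‖f x - c‖ₑ := by
          gcongr
          refine le_trans (ENNReal.ofReal_le_ofReal ?_) (abs_avg_sub_le hf Q c)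
          gcongr
      _ ≤ _ := le_add_self

/-- Both bounds are proved together by induction on the generation. The close-point bound on the
halves gives the mean bound one generation later with `16 + 52 = 68`, so the constants reproduce
themselves and no selection of stopping cubes is needed. -/
lemma dyadicMoment_avg_le (hf : LocallyIntegrable f volume)
    (hosc : ∀ Q : Cube, ∫⁻ x in Q.set, ‖f x - avg f Q‖ₑ ≤ ENNReal.ofReal (b * Q.len))
    (hb : 0 ≤ b) (n : ℕ) :
    (∀ Q : Cube, dyadicMoment f n Q (avg f Q) ≤ ENNReal.ofReal (68 * b ^ 2 * Q.len)) ∧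
    ∀ (Q : Cube) (c : ℝ), |avg f Q - c| ≤ 6 * b →
      dyadicMoment f n Q c
        ≤ ENNReal.ofReal (16 * b ^ 2 * Q.len)
          + ENNReal.ofReal (52 * b) * ∫⁻ x in Q.set, ‖f x - c‖ₑ := by
  induction n with
  | zero =>
    have h0 : ∀ Q : Cube, dyadicMoment f 0 Q (avg f Q) ≤ ENNReal.ofReal (68 * b ^ 2 * Q.len) := by
      intro Q
      simp [dyadicMoment_zero]
    exact ⟨h0, dyadicMoment_le_of_close hf hosc hb 0 h0 (by simp)⟩
  | succ n ih =>
    have h1 : ∀ Q : Cube,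
        dyadicMoment f (n + 1) Q (avg f Q) ≤ ENNReal.ofReal (68 * b ^ 2 * Q.len) := by
      intro Q
      have hL := Q.len_pos
      have hl := abs_avg_half_sub_le hf hosc hb Q.lower_subset Q.lower_len
      have hu := abs_avg_half_sub_le hf hosc hb Q.upper_subset Q.upper_len
      have h1 := ih.2 Q.lower (avg f Q) (by linarith)
      have h2 := ih.2 Q.upper (avg f Q) (by linarith)
      rw [dyadicMoment_succ]
      refine (add_le_add h1 h2).trans ?_
      rw [Q.lower_len, Q.upper_len, add_add_add_comm, ← mul_add, ← Q.setLIntegral_split,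
        ← ENNReal.ofReal_add (by positivity) (by positivity)]
      calc _ ≤ ENNReal.ofReal (16 * b ^ 2 * (Q.len / 2) + 16 * b ^ 2 * (Q.len / 2))
              + ENNReal.ofReal (52 * b) * ENNReal.ofReal (b * Q.len) := by
            gcongr
            exact hosc Q
        _ = _ := by
            rw [← ENNReal.ofReal_mul (by positivity), ← ENNReal.ofReal_add (by positivity)
              (by positivity)]
            congr 1
            ring
    refine ⟨h1, dyadicMoment_le_of_close hf hosc hb (n + 1) h1 fun k hk => ?_⟩
    obtain rfl : n = k := by omega
    exact ih.2

/-- A function of bounded mean oscillation has bounded quadratic mean oscillation. -/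
theorem lintegral_sq_sub_avg_le (hf : LocallyIntegrable f volume)
    (hosc : ∀ Q : Cube, ∫⁻ x in Q.set, ‖f x - avg f Q‖ₑ ≤ ENNReal.ofReal (b * Q.len))
    (hb : 0 ≤ b) (Q : Cube) :
    ∫⁻ x in Q.set, ENNReal.ofReal ((f x - avg f Q) ^ 2) ≤ ENNReal.ofReal (68 * b ^ 2 * Q.len) := by
  have hcont : Continuous fun y : ℝ => ENNReal.ofReal ((y - avg f Q) ^ 2) :=
    ENNReal.continuous_ofReal.comp (by fun_prop)
  -- The dyadic means converge to `f` almost everywhere, and Fatou's lemma transfers the bound,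
  -- which is uniform in the generation.
  calc ∫⁻ x in Q.set, ENNReal.ofReal ((f x - avg f Q) ^ 2)
      = ∫⁻ x in Q.set, Filter.liminf
          (fun n => ENNReal.ofReal ((dyadicAvg f n Q x - avg f Q) ^ 2)) Filter.atTop := by
        refine lintegral_congr_ae ?_
        filter_upwards [ae_tendsto_dyadicAvg hf Q] with x hx
        exact ((hcont.tendsto _).comp hx).liminf_eq.symm
    _ ≤ Filter.liminf (fun n => dyadicMoment f n Q (avg f Q)) Filter.atTop :=
        lintegral_liminf_le fun n =>
          (((measurable_dyadicAvg f n Q).sub_const _).pow_const 2).ennreal_ofReal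
    _ ≤ _ := by
        refine (Filter.liminf_le_liminf (Filter.Eventually.of_forall fun n =>
          (dyadicMoment_avg_le hf hosc hb n).1 Q)).trans ?_
        simp

end JohnNirenberg

/-! ### Norm estimates tested on upper bounds -/

/-- Testing on `β` strictly above `A` keeps `β` positive even when the seminorm vanishes, and lets
infima be replaced by actual competitors. -/
lemma le_ofReal_mul_of_forall {A B : ℝ≥0∞} {K : ℝ} (hK : 0 ≤ K) (hA : A < ∞)
    (h : ∀ β : ℝ, 0 < β → A < ENNReal.ofReal β → B ≤ ENNReal.ofReal (K * β)) :
    B ≤ ENNReal.ofReal K * A := by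
  rw [← ENNReal.ofReal_toReal hA.ne, ← ENNReal.ofReal_mul hK]
  have hcont : Continuous fun η : ℝ => ENNReal.ofReal (K * (A.toReal + η)) :=
    ENNReal.continuous_ofReal.comp (by fun_prop)
  have ht : Filter.Tendsto (fun η : ℝ => ENNReal.ofReal (K * (A.toReal + η)))
      (nhdsWithin 0 (Set.Ioi 0)) (nhds (ENNReal.ofReal (K * A.toReal))) := by
    have := (hcont.tendsto 0).mono_left (nhdsWithin_le_nhds (s := Set.Ioi 0))
    simpa using this
  refine ge_of_tendsto ht ?_
  filter_upwards [self_mem_nhdsWithin] with η hη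
  have hη' : 0 < η := hη
  have h0 : 0 ≤ A.toReal := ENNReal.toReal_nonneg
  refine h _ (by positivity) ((ENNReal.lt_ofReal_iff_toReal_lt hA.ne).2 (by linarith))

lemma exists_ofReal_gt {A : ℝ≥0∞} (hA : A < ∞) : ∃ β : ℝ, 0 < β ∧ A < ENNReal.ofReal β :=
  ⟨A.toReal + 1, by positivity, (ENNReal.lt_ofReal_iff_toReal_lt hA.ne).2 (by linarith)⟩

lemma div_volume_le_iff (Q : Cube) {a : ℝ≥0∞} {β : ℝ} :
    a / volume Q.set ≤ ENNReal.ofReal β ↔ a ≤ ENNReal.ofReal (β * Q.len) := by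
  have hL := Q.len_pos
  rw [Q.volume_set, ENNReal.ofReal_mul' hL.le]
  exact ENNReal.div_le_iff (by simpa using hL) ENNReal.ofReal_ne_top

lemma bmoNorm_le_iff {f : ℝ → ℝ} {β : ℝ} :
    bmoNorm f ≤ ENNReal.ofReal β ↔
      ∀ Q : Cube, ∫⁻ x in Q.set, ‖f x - avg f Q‖ₑ ≤ ENNReal.ofReal (β * Q.len) := by
  simp only [bmoNorm, iSup_le_iff, ← div_volume_le_iff, avg]

lemma lintegral_sub_avg_le {f : ℝ → ℝ} (hf : LocallyIntegrable f volume) (Q : Cube) (m : ℝ) :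
    ∫⁻ x in Q.set, ‖f x - avg f Q‖ₑ ≤ 2 * ∫⁻ x in Q.set, ‖f x - m‖ₑ := by
  calc ∫⁻ x in Q.set, ‖f x - avg f Q‖ₑ
      ≤ ∫⁻ x in Q.set, (‖f x - m‖ₑ + ‖avg f Q - m‖ₑ) := by
        refine lintegral_mono fun x => ?_
        have : f x - avg f Q = (f x - m) - (avg f Q - m) := by ring
        rw [this]
        exact enorm_sub_le
    _ = (∫⁻ x in Q.set, ‖f x - m‖ₑ) + ENNReal.ofReal (|avg f Q - m| * Q.len) := by
        rw [lintegral_add_right _ measurable_const, setLIntegral_const, Q.volume_set,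
          Real.enorm_eq_ofReal_abs, ← ENNReal.ofReal_mul (abs_nonneg _)]
    _ ≤ _ := by
        rw [two_mul]
        gcongr
        exact abs_avg_sub_le hf Q m

namespace OscillatingExponent

variable {p : ℝ → ℝ} {ε δ H R c : ℝ}

lemma varLp_le (h : OscillatingExponent p ε δ H R c) {Q : Cube} {f : ℝ → ℝ} {K : ℝ}
    (hf : luxNorm p (Q.set.indicator f) ≤ ENNReal.ofReal (K * scale p Q)) :
    varLp p Q f ≤ ENNReal.ofReal (K * (Real.exp H * R / c)) := by
  have hs := scale_pos p Q
  have hc := h.c_pos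
  have hR := h.R_pos
  refine (ENNReal.div_le_div hf (h.scale_le_luxNorm_chi_set Q)).trans ?_
  rw [← ENNReal.ofReal_div_of_pos (by positivity)]
  refine ENNReal.ofReal_le_ofReal (le_of_eq ?_)
  field_simp

lemma one_le_exp_H (h : OscillatingExponent p ε δ H R c) : 1 ≤ Real.exp H :=
  Real.one_le_exp h.H_nonneg

/-! ### `BMO` embeds into `BMO_X` -/

lemma luxNorm_sub_avg_le (h : OscillatingExponent p ε δ H R c) {f : ℝ → ℝ}
    (hf : LocallyIntegrable f volume) {β : ℝ} (hβ : 0 < β)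
    (hosc : ∀ Q : Cube, ∫⁻ x in Q.set, ‖f x - avg f Q‖ₑ ≤ ENNReal.ofReal (β * Q.len))
    (Q : Cube) :
    luxNorm p (Q.set.indicator fun x => f x - avg f Q)
      ≤ ENNReal.ofReal (69 * Real.exp H * β * scale p Q) := by
  have hs := scale_pos p Q
  have hH := h.one_le_exp_H
  have hL := Q.len_pos
  refine luxNorm_le (by positivity) ?_
  rw [modular_indicator h.one_le Q.measurableSet]
  -- Here `69 = 1 + 68` adds the constants of the first and second moments, using `u ^ p ≤ u + u ^
  -- 2`; `exp H` absorbs the distortion of `scale`.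
  set Λ := 69 * Real.exp H with hΛ
  have hΛ1 : 1 ≤ Λ := by linarith
  have hpt : ∀ x ∈ Q.set, ENNReal.ofReal (|(f x - avg f Q) / (Λ * β * scale p Q)| ^ p x)
      ≤ ENNReal.ofReal (Real.exp H / (Λ * Q.len)) * (ENNReal.ofReal β⁻¹ * ‖f x - avg f Q‖ₑ
          + ENNReal.ofReal (β⁻¹ ^ 2) * ENNReal.ofReal ((f x - avg f Q) ^ 2)) := by
    intro x hx
    set g := f x - avg f Q
    rw [Real.enorm_eq_ofReal_abs, ← ENNReal.ofReal_mul (by positivity),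
      ← ENNReal.ofReal_mul (by positivity), ← ENNReal.ofReal_add (by positivity) (by positivity),
      ← ENNReal.ofReal_mul (by positivity)]
    refine ENNReal.ofReal_le_ofReal ?_
    have hp := h.one_le x
    have e0 : |g / (Λ * β * scale p Q)| = (β⁻¹ * |g|) / (Λ * scale p Q) := by
      rw [abs_div, abs_of_pos (show 0 < Λ * β * scale p Q by positivity)]
      field_simp
    have e1 : (β⁻¹ * |g|) ^ p x ≤ β⁻¹ * |g| + β⁻¹ ^ 2 * g ^ 2 := by
      have hu : 0 ≤ β⁻¹ * |g| := by positivity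
      have hsq : β⁻¹ ^ 2 * g ^ 2 = (β⁻¹ * |g|) ^ 2 := by rw [mul_pow, sq_abs]
      rw [hsq]
      set u := β⁻¹ * |g|
      rcases le_total u 1 with h1 | h1
      · have : u ^ p x ≤ u := by
          rcases hu.eq_or_lt with h0 | h0
          · rw [← h0, Real.zero_rpow (by linarith)]
          · simpa using Real.rpow_le_rpow_of_exponent_ge h0 h1 hp
        nlinarith [sq_nonneg u]
      · have : u ^ p x ≤ u ^ (2 : ℝ) := Real.rpow_le_rpow_of_exponent_le h1 (h.le_two x)
        rw [Real.rpow_two] at this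
        linarith
    have e2 : Λ * (Real.exp (-H) * Q.len) ≤ (Λ * scale p Q) ^ p x := by
      rw [Real.mul_rpow (by positivity) hs.le]
      gcongr
      · simpa using Real.rpow_le_rpow_of_exponent_le hΛ1 hp
      · exact h.len_le_rpow_scale hx
    rw [e0, Real.div_rpow (by positivity) (by positivity)]
    calc (β⁻¹ * |g|) ^ p x / (Λ * scale p Q) ^ p x
        ≤ (β⁻¹ * |g| + β⁻¹ ^ 2 * g ^ 2) / (Λ * (Real.exp (-H) * Q.len)) := by gcongr
      _ = _ := by rw [Real.exp_neg]; field_simp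
  have hm1 : AEMeasurable (fun x => ‖f x - avg f Q‖ₑ) (volume.restrict Q.set) :=
    ((integrableOn_cube hf Q).aemeasurable.sub_const _).enorm
  have hm2 : AEMeasurable (fun x => ENNReal.ofReal ((f x - avg f Q) ^ 2))
      (volume.restrict Q.set) :=
    (((integrableOn_cube hf Q).aemeasurable.sub_const _).pow_const 2).ennreal_ofReal
  calc _ ≤ ∫⁻ x in Q.set, ENNReal.ofReal (Real.exp H / (Λ * Q.len))
          * (ENNReal.ofReal β⁻¹ * ‖f x - avg f Q‖ₑ
            + ENNReal.ofReal (β⁻¹ ^ 2) * ENNReal.ofReal ((f x - avg f Q) ^ 2)) :=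
        setLIntegral_mono' Q.measurableSet hpt
    _ = ENNReal.ofReal (Real.exp H / (Λ * Q.len))
          * (ENNReal.ofReal β⁻¹ * (∫⁻ x in Q.set, ‖f x - avg f Q‖ₑ)
            + ENNReal.ofReal (β⁻¹ ^ 2)
              * ∫⁻ x in Q.set, ENNReal.ofReal ((f x - avg f Q) ^ 2)) := by
        rw [lintegral_const_mul' _ _ ENNReal.ofReal_ne_top,
          lintegral_add_left' (hm1.const_mul _), lintegral_const_mul' _ _ ENNReal.ofReal_ne_top,
          lintegral_const_mul' _ _ ENNReal.ofReal_ne_top]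
    _ ≤ ENNReal.ofReal (Real.exp H / (Λ * Q.len))
          * (ENNReal.ofReal β⁻¹ * ENNReal.ofReal (β * Q.len)
            + ENNReal.ofReal (β⁻¹ ^ 2) * ENNReal.ofReal (68 * β ^ 2 * Q.len)) := by
        gcongr
        · exact hosc Q
        · exact lintegral_sq_sub_avg_le hf hosc hβ.le Q
    _ = 1 := by
        rw [← ENNReal.ofReal_mul (by positivity), ← ENNReal.ofReal_mul (by positivity),
          ← ENNReal.ofReal_add (by positivity) (by positivity), ← ENNReal.ofReal_mul (by positivity),
          ← ENNReal.ofReal_one]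
        congr 1
        rw [hΛ]
        field_simp
        norm_num

theorem bmo_embeds_bmoX (h : OscillatingExponent p ε δ H R c) :
    BMO.Embeds (BMOX (varLp p)) := by
  have hc := h.c_pos
  have hR := h.R_pos
  have hH := h.one_le_exp_H
  set K := 69 * Real.exp H * (Real.exp H * R / c) with hK
  have hK0 : 0 ≤ K := by positivity
  refine ⟨K.toNNReal, fun f hf => ?_⟩
  have key : bmoXNorm (varLp p) f ≤ ENNReal.ofReal K * bmoNorm f := by
    refine le_ofReal_mul_of_forall hK0 hf.2 fun β hβ hlt => iSup_le fun Q => ?_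
    refine (h.varLp_le (K := 69 * Real.exp H * β)
      (h.luxNorm_sub_avg_le hf.1 hβ (bmoNorm_le_iff.1 hlt.le) Q)).trans (le_of_eq ?_)
    rw [hK]
    congr 1
    ring
  exact ⟨⟨hf.1, key.trans_lt (ENNReal.mul_lt_top ENNReal.ofReal_lt_top hf.2)⟩, key⟩

/-! ### `BMO_X^*` embeds into `BMO` -/

lemma exists_modular_le_one (h : OscillatingExponent p ε δ H R c) {f : ℝ → ℝ} {β : ℝ}
    (hβ : bmoXStarNorm (varLp p) f < ENNReal.ofReal β) (Q : Cube) :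
    ∃ m : ℝ, ∫⁻ x in Q.set,
      ENNReal.ofReal (|(f x - m) / (β * Real.exp H * scale p Q)| ^ p x) ≤ 1 := by
  have hβ0 : 0 < β := ENNReal.ofReal_pos.1 (bot_le.trans_lt hβ)
  have h1 : ⨅ m : ℝ, varLp p Q (fun x => f x - m) < ENNReal.ofReal β :=
    (le_iSup (fun Q : Cube => ⨅ m : ℝ, varLp p Q (fun x => f x - m)) Q).trans_lt hβ
  obtain ⟨m, hm⟩ := iInf_lt_iff.1 h1
  refine ⟨m, ?_⟩
  rw [← modular_indicator h.one_le Q.measurableSet]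
  refine modular_le_one_of_luxNorm_lt h.one_le ?_
  have hc := h.c_pos
  have hR := h.R_pos
  have hs := scale_pos p Q
  have hpos : luxNorm p (chi Q.set) ≠ 0 :=
    (lt_of_lt_of_le (ENNReal.ofReal_pos.2 (by positivity)) (h.scale_le_luxNorm_chi_set Q)).ne'
  have htop : luxNorm p (chi Q.set) ≠ ∞ :=
    ((h.luxNorm_chi_set_le Q).trans_lt ENNReal.ofReal_lt_top).ne
  rw [varLp, ENNReal.div_lt_iff (Or.inl hpos) (Or.inl htop)] at hm
  refine hm.trans_le ?_
  rw [mul_assoc, ENNReal.ofReal_mul hβ0.le]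
  gcongr
  exact h.luxNorm_chi_set_le Q

lemma lintegral_sub_le_of_len_le (h : OscillatingExponent p ε δ H R c) {f : ℝ → ℝ} {B m : ℝ}
    (hB : 0 < B) {Q : Cube} (hQ : Q.len ≤ 2 * R)
    (hm : ∫⁻ x in Q.set, ENNReal.ofReal (|(f x - m) / (B * scale p Q)| ^ p x) ≤ 1) :
    ∫⁻ x in Q.set, ‖f x - m‖ₑ ≤ ENNReal.ofReal ((1 + 2 * R * Real.exp H) * B * Q.len) := by
  have hs := scale_pos p Q
  have hL := Q.len_pos
  have hR := h.R_pos
  have hpt : ∀ x ∈ Q.set, ‖f x - m‖ₑ ≤ ENNReal.ofReal B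
      + ENNReal.ofReal (B * (Real.exp H * (2 * R) * Q.len))
        * ENNReal.ofReal (|(f x - m) / (B * scale p Q)| ^ p x) := by
    intro x hx
    set g := f x - m
    rw [Real.enorm_eq_ofReal_abs, ← ENNReal.ofReal_mul (by positivity),
      ← ENNReal.ofReal_add hB.le (by positivity)]
    refine ENNReal.ofReal_le_ofReal ?_
    have hp := h.one_le x
    have e1 : |g| / B ≤ 1 + (|g| / B) ^ p x := by
      have hu : 0 ≤ |g| / B := by positivity
      rcases le_total (|g| / B) 1 with h1 | h1
      · have := Real.rpow_nonneg hu (p x)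
        linarith
      · have := Real.rpow_le_rpow_of_exponent_le h1 hp
        rw [Real.rpow_one] at this
        linarith
    have e2 : (|g| / B) ^ p x = scale p Q ^ p x * |g / (B * scale p Q)| ^ p x := by
      rw [← Real.mul_rpow hs.le (abs_nonneg _), abs_div,
        abs_of_pos (show 0 < B * scale p Q by positivity)]
      congr 1
      field_simp
    have e3 := h.rpow_scale_le (by linarith [h.one_le_R]) hQ hx
    have e4 : 0 ≤ |g / (B * scale p Q)| ^ p x := by positivity
    rw [div_le_iff₀ hB, e2] at e1
    calc |g| ≤ (1 + scale p Q ^ p x * |g / (B * scale p Q)| ^ p x) * B := e1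
      _ ≤ (1 + Real.exp H * (2 * R) * Q.len * |g / (B * scale p Q)| ^ p x) * B := by gcongr
      _ = _ := by ring
  calc ∫⁻ x in Q.set, ‖f x - m‖ₑ
      ≤ ∫⁻ x in Q.set, (ENNReal.ofReal B
        + ENNReal.ofReal (B * (Real.exp H * (2 * R) * Q.len))
          * ENNReal.ofReal (|(f x - m) / (B * scale p Q)| ^ p x)) :=
        setLIntegral_mono' Q.measurableSet hpt
    _ = ENNReal.ofReal (B * Q.len) + ENNReal.ofReal (B * (Real.exp H * (2 * R) * Q.len))
          * ∫⁻ x in Q.set, ENNReal.ofReal (|(f x - m) / (B * scale p Q)| ^ p x) := by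
        rw [lintegral_add_left measurable_const, lintegral_const_mul' _ _ ENNReal.ofReal_ne_top,
          setLIntegral_const, Q.volume_set, ← ENNReal.ofReal_mul hB.le]
    _ ≤ ENNReal.ofReal (B * Q.len) + ENNReal.ofReal (B * (Real.exp H * (2 * R) * Q.len)) * 1 := by
        gcongr
    _ = _ := by
        rw [mul_one, ← ENNReal.ofReal_add (by positivity) (by positivity)]
        congr 1
        ring

/-- Where `p = 1` the modular is the weighted `L^1` norm itself, and on a long cube the weight is `1
/ (B * |Q|)`. -/
lemma lintegral_low_sub_le (h : OscillatingExponent p ε δ H R c) {f : ℝ → ℝ} {B m : ℝ}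
    (hB : 0 < B) {Q : Cube} (hQ : R < Q.len)
    (hm : ∫⁻ x in Q.set, ENNReal.ofReal (|(f x - m) / (B * scale p Q)| ^ p x) ≤ 1) :
    ∫⁻ x in Q.set, {x | p x = 1}.indicator (fun x => ‖f x - m‖ₑ) x
      ≤ ENNReal.ofReal (B * Q.len) := by
  have hL := Q.len_pos
  have hs : scale p Q = Q.len := if_neg (not_le.2 (h.one_le_R.trans_lt hQ))
  rw [hs] at hm
  calc ∫⁻ x in Q.set, {x | p x = 1}.indicator (fun x => ‖f x - m‖ₑ) x
      ≤ ∫⁻ x in Q.set, ENNReal.ofReal (B * Q.len)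
          * ENNReal.ofReal (|(f x - m) / (B * Q.len)| ^ p x) := by
        refine lintegral_mono fun x => ?_
        by_cases hx : p x = 1
        · rw [Set.indicator_of_mem (by exact hx), hx, Real.rpow_one, Real.enorm_eq_ofReal_abs,
            ← ENNReal.ofReal_mul (by positivity), abs_div,
            abs_of_pos (show 0 < B * Q.len by positivity)]
          refine ENNReal.ofReal_le_ofReal (le_of_eq ?_)
          field_simp
        · rw [Set.indicator_of_notMem (by exact hx)]
          exact zero_le
    _ = ENNReal.ofReal (B * Q.len)
          * ∫⁻ x in Q.set, ENNReal.ofReal (|(f x - m) / (B * Q.len)| ^ p x) :=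
        lintegral_const_mul' _ _ ENNReal.ofReal_ne_top
    _ ≤ _ := mul_le_of_le_one_right' hm

/-- If `f` oscillates little on `Q`, then its mean deviation from any `m` is controlled by the
deviation on the set where the exponent is one. -/
lemma lintegral_sub_le_add_low (h : OscillatingExponent p ε δ H R c) {f : ℝ → ℝ}
    (hf : AEMeasurable f volume) {Q : Cube} (hQ : R ≤ Q.len) {K m' : ℝ} (hK : 0 ≤ K)
    (hm' : ∫⁻ x in Q.set, ‖f x - m'‖ₑ ≤ ENNReal.ofReal (K * Q.len)) (m : ℝ) :
    ∫⁻ x in Q.set, ‖f x - m‖ₑ ≤ ENNReal.ofReal ((1 + 1 / c) * K * Q.len)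
      + ENNReal.ofReal (1 / c)
        * ∫⁻ x in Q.set, {x | p x = 1}.indicator (fun x => ‖f x - m‖ₑ) x := by
  have hc := h.c_pos
  have hL := Q.len_pos
  set G : Set ℝ := {x | p x = 1}
  have hG : MeasurableSet G := h.measurableSet_low
  have hvol : ENNReal.ofReal (c * Q.len) ≤ volume (Q.set ∩ G) :=
    h.le_volume_low hQ subset_rfl (by
      calc ENNReal.ofReal δ * volume Q.set ≤ 1 * volume Q.set := by
            gcongr; exact ENNReal.ofReal_le_one.2 h.δ_lt.le
        _ = _ := one_mul _)
  -- The constant `|m' - m|` is integrated over the low part of `Q` only; its measure is at least `c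
  -- * |Q|`.
  have h1 : ENNReal.ofReal (|m' - m| * (c * Q.len))
      ≤ ENNReal.ofReal (K * Q.len) + ∫⁻ x in Q.set, G.indicator (fun x => ‖f x - m‖ₑ) x := by
    calc ENNReal.ofReal (|m' - m| * (c * Q.len))
        = ENNReal.ofReal |m' - m| * ENNReal.ofReal (c * Q.len) := ENNReal.ofReal_mul (abs_nonneg _)
      _ ≤ ENNReal.ofReal |m' - m| * volume (Q.set ∩ G) := by gcongr
      _ = ∫⁻ x in Q.set, G.indicator (fun _ => ENNReal.ofReal |m' - m|) x := by
          rw [lintegral_indicator hG, Measure.restrict_restrict hG, setLIntegral_const,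
            Set.inter_comm]
      _ ≤ ∫⁻ x in Q.set, (‖f x - m'‖ₑ + G.indicator (fun x => ‖f x - m‖ₑ) x) := by
          refine lintegral_mono fun x => ?_
          by_cases hx : x ∈ G
          · rw [Set.indicator_of_mem hx, Set.indicator_of_mem hx, ← Real.enorm_eq_ofReal_abs]
            have : m' - m = (f x - m) - (f x - m') := by ring
            rw [this, add_comm]
            exact enorm_sub_le
          · simp [hx]
      _ = (∫⁻ x in Q.set, ‖f x - m'‖ₑ)
            + ∫⁻ x in Q.set, G.indicator (fun x => ‖f x - m‖ₑ) x :=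
          lintegral_add_left' ((hf.sub_const m').enorm.restrict) _
      _ ≤ _ := by gcongr
  calc ∫⁻ x in Q.set, ‖f x - m‖ₑ
      ≤ ∫⁻ x in Q.set, (‖f x - m'‖ₑ + ‖m' - m‖ₑ) := by
        refine lintegral_mono fun x => ?_
        have : f x - m = (f x - m') + (m' - m) := by ring
        rw [this]
        exact enorm_add_le _ _
    _ = (∫⁻ x in Q.set, ‖f x - m'‖ₑ) + ENNReal.ofReal (|m' - m| * Q.len) := by
        rw [lintegral_add_right _ measurable_const, setLIntegral_const, Q.volume_set,
          Real.enorm_eq_ofReal_abs, ← ENNReal.ofReal_mul (abs_nonneg _)]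
    _ = (∫⁻ x in Q.set, ‖f x - m'‖ₑ)
          + ENNReal.ofReal (1 / c) * ENNReal.ofReal (|m' - m| * (c * Q.len)) := by
        rw [← ENNReal.ofReal_mul (by positivity)]
        congr 2
        field_simp
    _ ≤ ENNReal.ofReal (K * Q.len) + ENNReal.ofReal (1 / c) * (ENNReal.ofReal (K * Q.len)
          + ∫⁻ x in Q.set, G.indicator (fun x => ‖f x - m‖ₑ) x) := by gcongr
    _ = _ := by
        rw [mul_add, ← add_assoc, ← ENNReal.ofReal_mul (by positivity),
          ← ENNReal.ofReal_add (by positivity) (by positivity)]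
        congr 2
        ring

/-- The preceding bound passes from the scale `R` to all larger scales by halving. -/
lemma lintegral_sub_le_add_low_of_le (h : OscillatingExponent p ε δ H R c) {f : ℝ → ℝ}
    (hf : AEMeasurable f volume) {K : ℝ} (hK : 0 ≤ K)
    (hosc : ∀ Q : Cube, Q.len ≤ 2 * R →
      ∃ m, ∫⁻ x in Q.set, ‖f x - m‖ₑ ≤ ENNReal.ofReal (K * Q.len)) (m : ℝ) (n : ℕ)
    (Q : Cube) (hQ : R ≤ Q.len) (hQn : Q.len ≤ 2 ^ n * (2 * R)) :
    ∫⁻ x in Q.set, ‖f x - m‖ₑ ≤ ENNReal.ofReal ((1 + 1 / c) * K * Q.len)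
      + ENNReal.ofReal (1 / c)
        * ∫⁻ x in Q.set, {x | p x = 1}.indicator (fun x => ‖f x - m‖ₑ) x := by
  induction n generalizing Q with
  | zero =>
    obtain ⟨m', hm'⟩ := hosc Q (by simpa using hQn)
    exact h.lintegral_sub_le_add_low hf hQ hK hm' m
  | succ n ih =>
    rcases le_or_gt Q.len (2 * R) with h2 | h2
    · obtain ⟨m', hm'⟩ := hosc Q h2
      exact h.lintegral_sub_le_add_low hf hQ hK hm' m
    · have hc := h.c_pos
      have hL := Q.len_pos
      rw [pow_succ] at hQn
      have h1 := ih Q.lower (by rw [Q.lower_len]; linarith) (by rw [Q.lower_len]; linarith)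
      have h2 := ih Q.upper (by rw [Q.upper_len]; linarith) (by rw [Q.upper_len]; linarith)
      -- With `m` fixed, every term of the bound is additive over the two halves, so nothing is lost
      -- in the constants.
      rw [Q.setLIntegral_split, Q.setLIntegral_split, mul_add]
      refine (add_le_add h1 h2).trans (le_of_eq ?_)
      rw [Q.lower_len, Q.upper_len, add_add_add_comm, ← ENNReal.ofReal_add (by positivity)
        (by positivity)]
      congr 2
      ring

lemma exists_lintegral_sub_le (h : OscillatingExponent p ε δ H R c) {f : ℝ → ℝ}
    (hf : AEMeasurable f volume) {β : ℝ} (hβ : bmoXStarNorm (varLp p) f < ENNReal.ofReal β)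
    (Q : Cube) :
    ∃ m, ∫⁻ x in Q.set, ‖f x - m‖ₑ ≤ ENNReal.ofReal
      (((1 + 1 / c) * (1 + 2 * R * Real.exp H) + 1 / c) * Real.exp H * β * Q.len) := by
  have hβ0 : 0 < β := ENNReal.ofReal_pos.1 (bot_le.trans_lt hβ)
  have hc := h.c_pos
  have hR := h.R_pos
  have hL := Q.len_pos
  set K := 1 + 2 * R * Real.exp H
  have hK0 : 0 < K := by positivity
  have hsmall : ∀ Q : Cube, Q.len ≤ 2 * R →
      ∃ m, ∫⁻ x in Q.set, ‖f x - m‖ₑ ≤ ENNReal.ofReal (K * (β * Real.exp H) * Q.len) := by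
    intro Q hQ
    obtain ⟨m, hm⟩ := h.exists_modular_le_one hβ Q
    exact ⟨m, h.lintegral_sub_le_of_len_le (by positivity) hQ hm⟩
  rcases le_or_gt Q.len R with hQ | hQ
  · obtain ⟨m, hm⟩ := hsmall Q (by linarith)
    refine ⟨m, hm.trans (ENNReal.ofReal_le_ofReal ?_)⟩
    have : K ≤ (1 + 1 / c) * K + 1 / c := by
      have h1 : 0 < 1 / c := by positivity
      nlinarith
    calc K * (β * Real.exp H) * Q.len
        ≤ ((1 + 1 / c) * K + 1 / c) * (β * Real.exp H) * Q.len := by gcongr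
      _ = _ := by ring
  · obtain ⟨m, hm⟩ := h.exists_modular_le_one hβ Q
    obtain ⟨n, hn⟩ := pow_unbounded_of_one_lt (Q.len / (2 * R)) one_lt_two
    rw [div_lt_iff₀ (by positivity)] at hn
    refine ⟨m, (h.lintegral_sub_le_add_low_of_le hf (by positivity) hsmall m n Q hQ.le
      hn.le).trans ?_⟩
    calc _ ≤ ENNReal.ofReal ((1 + 1 / c) * (K * (β * Real.exp H)) * Q.len)
          + ENNReal.ofReal (1 / c) * ENNReal.ofReal (β * Real.exp H * Q.len) := by
          gcongr
          exact h.lintegral_low_sub_le (by positivity) hQ hm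
      _ = _ := by
          rw [← ENNReal.ofReal_mul (by positivity), ← ENNReal.ofReal_add (by positivity)
            (by positivity)]
          congr 1
          ring

lemma _root_.VarExpBMO.locallyIntegrable_of_cubes {f : ℝ → ℝ} (hf : AEMeasurable f volume)
    (h : ∀ Q : Cube, ∃ m : ℝ, ∫⁻ x in Q.set, ‖f x - m‖ₑ < ∞) : LocallyIntegrable f volume := by
  rw [locallyIntegrable_iff]
  intro k hk
  obtain ⟨r, hr⟩ := hk.isBounded.subset_closedBall 0
  rw [Real.closedBall_eq_Icc] at hr
  let Q : Cube := ⟨-(|r| + 1), |r| + 1, by linarith [abs_nonneg r]⟩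
  have hkQ : k ⊆ Q.set := hr.trans (Set.Icc_subset_Icc (by simp [Q]; linarith [le_abs_self r])
    (by simp [Q]; linarith [le_abs_self r]))
  refine IntegrableOn.mono_set ?_ hkQ
  obtain ⟨m, hm⟩ := h Q
  have h1 : IntegrableOn (fun x => f x - m) Q.set volume :=
    ⟨(hf.sub_const m).aestronglyMeasurable.restrict, hm⟩
  have h2 : IntegrableOn (fun _ : ℝ => m) Q.set volume :=
    integrableOn_const (by simp [Q.volume_set])
  exact (h1.add h2).congr_fun (fun x _ => by simp) Q.measurableSet

theorem bmoXStar_embeds_bmo (h : OscillatingExponent p ε δ H R c) :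
    (BMOXStar (varLp p)).Embeds BMO := by
  have hc := h.c_pos
  have hR := h.R_pos
  set K := ((1 + 1 / c) * (1 + 2 * R * Real.exp H) + 1 / c) * Real.exp H with hK
  have hK0 : 0 ≤ K := by positivity
  refine ⟨(2 * K).toNNReal, fun f hf => ?_⟩
  have hloc : LocallyIntegrable f volume := by
    obtain ⟨β, -, hβ⟩ := exists_ofReal_gt hf.2
    refine locallyIntegrable_of_cubes hf.1 fun Q => ?_
    obtain ⟨m, hm⟩ := h.exists_lintegral_sub_le hf.1 hβ Q
    exact ⟨m, hm.trans_lt ENNReal.ofReal_lt_top⟩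
  have key : bmoNorm f ≤ ENNReal.ofReal (2 * K) * bmoXStarNorm (varLp p) f := by
    refine le_ofReal_mul_of_forall (by positivity) hf.2 fun β hβ hlt => bmoNorm_le_iff.2 fun Q => ?_
    obtain ⟨m, hm⟩ := h.exists_lintegral_sub_le hf.1 hlt Q
    refine (lintegral_sub_avg_le hloc Q m).trans ((mul_le_mul_right hm 2).trans (le_of_eq ?_))
    rw [← ENNReal.ofReal_ofNat, ← ENNReal.ofReal_mul (by norm_num)]
    congr 1
    rw [hK]
    ring
  exact ⟨⟨hloc, key.trans_lt (ENNReal.mul_lt_top ENNReal.ofReal_lt_top hf.2)⟩, key⟩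

end OscillatingExponent

/-! ### Equality of the spaces -/

lemma bmoX_embeds_bmoXStar (X : NormFamily) : (BMOX X).Embeds (BMOXStar X) := by
  refine ⟨1, fun f hf => ?_⟩
  have key : bmoXStarNorm X f ≤ bmoXNorm X f :=
    iSup_mono fun Q => iInf_le (fun m : ℝ => X Q fun x => f x - m) (⨍ y in Q.set, f y)
  refine ⟨⟨hf.1.aestronglyMeasurable.aemeasurable, key.trans_lt hf.2⟩, ?_⟩
  rw [ENNReal.coe_one, one_mul]
  exact key

lemma FunctionSpace.Embeds.trans {A B C : FunctionSpace} (hAB : A.Embeds B) (hBC : B.Embeds C) :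
    A.Embeds C := by
  obtain ⟨K, hK⟩ := hAB
  obtain ⟨L, hL⟩ := hBC
  refine ⟨L * K, fun f hf => ⟨(hL f (hK f hf).1).1, (hL f (hK f hf).1).2.trans ?_⟩⟩
  rw [ENNReal.coe_mul, mul_assoc]
  gcongr
  exact (hK f hf).2

lemma FunctionSpace.Embeds.same {A B : FunctionSpace} (hAB : A.Embeds B) (hBA : B.Embeds A) :
    A.Same B :=
  ⟨Set.Subset.antisymm (fun f hf => (hAB.choose_spec f hf).1)
    (fun f hf => (hBA.choose_spec f hf).1), hAB, hBA⟩

namespace OscillatingExponent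

variable {p : ℝ → ℝ} {ε δ H R c : ℝ}

theorem bmo_same_bmoX (h : OscillatingExponent p ε δ H R c) : BMO.Same (BMOX (varLp p)) :=
  h.bmo_embeds_bmoX.same ((bmoX_embeds_bmoXStar _).trans h.bmoXStar_embeds_bmo)

theorem bmoX_same_bmoXStar (h : OscillatingExponent p ε δ H R c) :
    (BMOX (varLp p)).Same (BMOXStar (varLp p)) :=
  (bmoX_embeds_bmoXStar _).same (h.bmoXStar_embeds_bmo.trans h.bmo_embeds_bmoX)

end OscillatingExponent

/-! ### The conditions on characteristic functions: `A_δ` holds, `ψ_X` decays, `A_ε` fails -/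

lemma varLp_chi (p : ℝ → ℝ) {Q : Cube} {E : Set ℝ} (hE : E ⊆ Q.set) :
    varLp p Q (chi E) = luxNorm p (chi E) / luxNorm p (chi Q.set) := by
  rw [varLp, chi, Set.indicator_indicator, Set.inter_eq_self_of_subset_right hE]

/-- The cube `[0, N]`. -/
def initialCube (N : ℕ) (hN : 2 ≤ N) : Cube where
  left := 0
  right := N
  left_lt_right := by exact_mod_cast (by omega : 0 < N)

lemma initialCube_len (N : ℕ) (hN : 2 ≤ N) : (initialCube N hN).len = N := sub_zero _

lemma scale_initialCube (p : ℝ → ℝ) (N : ℕ) (hN : 2 ≤ N) : scale p (initialCube N hN) = N := by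
  have : ¬ (N : ℝ) ≤ 1 := by exact_mod_cast (by omega : ¬ N ≤ 1)
  rw [scale, initialCube_len, if_neg this]

lemma exists_nat_sqrt_gt (K : ℝ) : ∃ N : ℕ, 2 ≤ N ∧ K < √N := by
  obtain ⟨N, hN⟩ := exists_nat_gt (K ^ 2 + 2)
  have h2 : (2 : ℝ) ≤ N := by nlinarith [sq_nonneg K]
  exact ⟨N, by exact_mod_cast h2, Real.lt_sqrt_of_sq_lt (by linarith)⟩

namespace OscillatingExponent

variable {p : ℝ → ℝ} {ε δ H R c : ℝ}

theorem condA (h : OscillatingExponent p ε δ H R c) : CondA δ (varLp p) := by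
  have hc := h.c_pos
  have hR := h.R_pos
  refine ⟨(c / (Real.exp H * R) / Real.exp H).toNNReal, by simp; positivity,
    fun Q E hEm hE hEv => ?_⟩
  have hs := scale_pos p Q
  rw [varLp_chi p hE]
  refine le_trans ?_ (ENNReal.div_le_div (h.scale_le_luxNorm_chi hEm hE hEv)
    (h.luxNorm_chi_set_le Q))
  rw [← ENNReal.ofReal_div_of_pos (by positivity)]
  refine ENNReal.ofReal_le_ofReal (le_of_eq ?_)
  field_simp

theorem psi_le (h : OscillatingExponent p ε δ H R c) :
    ∃ C : ℝ≥0, ∀ t : ℝ, 0 < t → t < 1 →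
      psi (varLp p) t ≤ C * ENNReal.ofReal (t ^ (1 / 2 : ℝ)) := by
  have hc := h.c_pos
  have hR := h.R_pos
  refine ⟨(Real.exp H * (Real.exp H * R / c)).toNNReal, fun t ht ht1 => ?_⟩
  have hr : 0 < t ^ (1 / 2 : ℝ) := Real.rpow_pos_of_pos ht _
  refine iSup_le fun Q => iSup_le fun E => iSup_le fun hEm => iSup_le fun hE => iSup_le fun hEv => ?_
  refine (h.varLp_le (K := Real.exp H * t ^ (1 / 2 : ℝ)) ?_).trans (le_of_eq ?_)
  · rw [chi, Set.indicator_indicator, Set.inter_eq_self_of_subset_right hE, mul_assoc]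
    exact h.luxNorm_chi_le hEm hE ht ht1.le hEv
  · change _ = ENNReal.ofReal _ * _
    rw [← ENNReal.ofReal_mul (by positivity)]
    congr 1
    ring

/-- The part of `[0, N]` on which the exponent is two. -/
def _root_.VarExpBMO.highPart (p : ℝ → ℝ) (N : ℕ) : Set ℝ := Set.Icc 0 (N : ℝ) ∩ {x | p x = 2}

lemma measurableSet_highPart (h : OscillatingExponent p ε δ H R c) (N : ℕ) :
    MeasurableSet (highPart p N) := measurableSet_Icc.inter h.measurableSet_high

lemma modular_highPart_le (h : OscillatingExponent p ε δ H R c) {N : ℕ} (hN : 2 ≤ N) :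
    ∫⁻ x, ENNReal.ofReal (|chi (highPart p N) x / √N| ^ p x) ≤ 1 := by
  have hN0 : (0 : ℝ) < N := by exact_mod_cast (by omega : 0 < N)
  rw [modular_chi h.one_le (h.measurableSet_highPart N) (Real.sqrt_pos.2 hN0)]
  calc ∫⁻ x in highPart p N, ENNReal.ofReal ((√N)⁻¹ ^ p x)
      = ∫⁻ x in highPart p N, ENNReal.ofReal (N : ℝ)⁻¹ :=
        setLIntegral_congr_fun (h.measurableSet_highPart N) fun x hx => by
          have : p x = 2 := hx.2
          simp only [this, Real.rpow_two, inv_pow, Real.sq_sqrt hN0.le]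
    _ ≤ ENNReal.ofReal (N : ℝ)⁻¹ * volume (Set.Icc 0 (N : ℝ)) := by
        rw [setLIntegral_const]
        gcongr
        exact Set.inter_subset_left
    _ = 1 := by
        rw [Real.volume_Icc, sub_zero, ← ENNReal.ofReal_mul (by positivity),
          inv_mul_cancel₀ hN0.ne', ENNReal.ofReal_one]

lemma luxNorm_highPart_le (h : OscillatingExponent p ε δ H R c) {N : ℕ} (hN : 2 ≤ N) :
    luxNorm p (chi (highPart p N)) ≤ ENNReal.ofReal √N :=
  luxNorm_le (Real.sqrt_pos.2 (by exact_mod_cast (by omega : 0 < N))) (h.modular_highPart_le hN)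

lemma le_luxNorm_initialCube (h : OscillatingExponent p ε δ H R c) {N : ℕ} (hN : 2 ≤ N) :
    ENNReal.ofReal (c / (Real.exp H * R) * N) ≤ luxNorm p (chi (Set.Icc 0 (N : ℝ))) := by
  have := h.scale_le_luxNorm_chi_set (initialCube N hN)
  rwa [scale_initialCube] at this

theorem not_condA (h : OscillatingExponent p ε δ H R c) : ¬ CondA ε (varLp p) := by
  rintro ⟨k, hk, hA⟩
  have hc := h.c_pos
  have hR := h.R_pos
  set κ := c / (Real.exp H * R) with hκ
  have hκ0 : 0 < κ := by positivity
  have hk' : (0 : ℝ) < k := by exact_mod_cast hk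
  obtain ⟨N, hN, hNK⟩ := exists_nat_sqrt_gt (1 / (k * κ))
  have hN0 : (0 : ℝ) < N := by exact_mod_cast (by omega : 0 < N)
  have hr : 0 < √(N : ℝ) := Real.sqrt_pos.2 hN0
  have hsub : highPart p N ⊆ (initialCube N hN).set := Set.inter_subset_left
  have h1 := hA (initialCube N hN) (highPart p N) (h.measurableSet_highPart N) hsub (by
    rw [Cube.volume_set, initialCube_len, ← ENNReal.ofReal_mul h.ε_pos.le]
    exact h.high N)
  rw [varLp_chi p hsub] at h1
  have h2 := h1.trans (ENNReal.div_le_div (h.luxNorm_highPart_le hN) (h.le_luxNorm_initialCube hN))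
  rw [← ENNReal.ofReal_div_of_pos (by positivity), ← ENNReal.ofReal_coe_nnreal,
    ENNReal.ofReal_le_ofReal_iff (by positivity), ← hκ, le_div_iff₀ (by positivity)] at h2
  rw [div_lt_iff₀ (by positivity)] at hNK
  nlinarith [Real.mul_self_sqrt hN0.le]

/-! ### Failure of the maximal inequalities on `X` and `X'` -/

/-- The maximal function of a set that has a fixed proportion of `[0, N]`. -/
lemma _root_.VarExpBMO.le_maximal_chi {E : Set ℝ} (hE : MeasurableSet E) {N : ℕ} (hN : 2 ≤ N)
    {a : ℝ} (hEv : ENNReal.ofReal (a * N) ≤ volume (Set.Icc 0 (N : ℝ) ∩ E))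
    {x : ℝ} (hx : x ∈ Set.Icc 0 (N : ℝ)) : ENNReal.ofReal a ≤ maximal (chi E) x := by
  refine le_trans ?_ (le_iSup₂_of_le (initialCube N hN) hx le_rfl)
  have hN0 : (0 : ℝ) < N := by exact_mod_cast (by omega : 0 < N)
  have e : ∫⁻ y in (initialCube N hN).set, ‖chi E y‖ₑ = volume (Set.Icc 0 (N : ℝ) ∩ E) := by
    have : ∀ y, ‖chi E y‖ₑ = E.indicator 1 y := by
      intro y
      by_cases hy : y ∈ E <;> simp [chi, hy]
    simp_rw [this]
    rw [lintegral_indicator_one hE, Measure.restrict_apply hE, Set.inter_comm]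
    rfl
  rw [e, ENNReal.le_div_iff_mul_le (Or.inl ?_) (Or.inl ?_)]
  · rwa [Cube.volume_set, initialCube_len, ← ENNReal.ofReal_mul' hN0.le]
  · simpa [Cube.volume_set, initialCube_len] using (by omega : N ≠ 0)
  · simp [Cube.volume_set]

theorem not_restrictedWeakType (h : OscillatingExponent p ε δ H R c) :
    ¬ MaximalRestrictedWeakType p := by
  rintro ⟨C, hC⟩
  have hc := h.c_pos
  have hR := h.R_pos
  have hε := h.ε_pos
  set κ := c / (Real.exp H * R) with hκ
  have hκ0 : 0 < κ := by positivity
  obtain ⟨N, hN, hNK⟩ := exists_nat_sqrt_gt (C / (ε / 2 * κ))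
  have hN0 : (0 : ℝ) < N := by exact_mod_cast (by omega : 0 < N)
  have hr : 0 < √(N : ℝ) := Real.sqrt_pos.2 hN0
  -- The level is `ε / 2` because the superlevel set is strict while the maximal function is only
  -- known to be at least `ε`.
  have hmem : Set.Icc 0 (N : ℝ)
      ⊆ {x | (((ε / 2).toNNReal : ℝ≥0) : ℝ≥0∞) < maximal (chi (highPart p N)) x} := by
    intro x hx
    refine lt_of_lt_of_le ?_ (le_maximal_chi (h.measurableSet_highPart N) hN (a := ε) ?_ hx)
    · exact (ENNReal.ofReal_lt_ofReal_iff hε).2 (by linarith)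
    · rw [highPart, ← Set.inter_assoc, Set.inter_self]
      exact h.high N
  have h1 := hC (highPart p N) (h.measurableSet_highPart N) (ε / 2).toNNReal
    (by simpa using hε)
  have h2 : ENNReal.ofReal (ε / 2) * ENNReal.ofReal (κ * N) ≤ C * ENNReal.ofReal √N :=
    calc _ ≤ ENNReal.ofReal (ε / 2) * luxNorm p (chi (Set.Icc 0 (N : ℝ))) := by
          gcongr
          exact h.le_luxNorm_initialCube hN
      _ ≤ _ := by
          exact mul_le_mul_right (luxNorm_chi_mono h.one_le hmem) _
      _ ≤ _ := h1
      _ ≤ _ := by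
          gcongr
          exact h.luxNorm_highPart_le hN
  rw [← ENNReal.ofReal_mul (by positivity), ← ENNReal.ofReal_coe_nnreal,
    ← ENNReal.ofReal_mul C.coe_nonneg, ENNReal.ofReal_le_ofReal_iff (by positivity)] at h2
  rw [div_lt_iff₀ (by positivity)] at hNK
  nlinarith [Real.mul_self_sqrt hN0.le]

/-- Characteristic functions of sets where the exponent is one lie in the associate space. -/
lemma assocNorm_low_le (h : OscillatingExponent p ε δ H R c) {E : Set ℝ}
    (hE : E ⊆ {x | p x = 1}) : assocNorm p (fun x => ‖chi E x‖ₑ) ≤ 2 := by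
  refine iSup_le fun f => iSup_le fun _ => iSup_le fun hf => ?_
  -- Dividing by `2` makes the norm inequality strict, so the modular bound follows without
  -- attainment of the infimum.
  have hm : ∫⁻ x, ENNReal.ofReal (|f x / 2| ^ p x) ≤ 1 :=
    modular_le_one_of_luxNorm_lt h.one_le (hf.trans_lt (by norm_num))
  calc ∫⁻ x, ‖f x‖ₑ * ‖chi E x‖ₑ
      ≤ ∫⁻ x, 2 * ENNReal.ofReal (|f x / 2| ^ p x) := by
        refine lintegral_mono fun x => ?_
        by_cases hx : x ∈ E
        · have hp : p x = 1 := hE hx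
          have h2 : |(2 : ℝ)| = 2 := abs_of_pos two_pos
          rw [hp, Real.rpow_one, ← ENNReal.ofReal_ofNat, ← ENNReal.ofReal_mul (by norm_num),
            abs_div, h2, mul_div_cancel₀ _ two_ne_zero, Real.enorm_eq_ofReal_abs]
          simp [chi, hx]
        · simp [chi, hx]
    _ = 2 * ∫⁻ x, ENNReal.ofReal (|f x / 2| ^ p x) := lintegral_const_mul' _ _ (by norm_num)
    _ ≤ 2 := mul_le_of_le_one_right' hm

theorem not_maximalBoundedOnAssociate (h : OscillatingExponent p ε δ H R c) :
    ¬ MaximalBoundedOnAssociate p := by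
  rintro ⟨C, hC⟩
  have hc := h.c_pos
  have hε := h.ε_pos
  obtain ⟨N, hN, hNK⟩ := exists_nat_sqrt_gt (max R (C * 2 / (c * ε)))
  have hN0 : (0 : ℝ) < N := by exact_mod_cast (by omega : 0 < N)
  have hr : 0 < √(N : ℝ) := Real.sqrt_pos.2 hN0
  have hsq := Real.mul_self_sqrt hN0.le
  have hNR : R ≤ N := by
    have h1 := (le_max_left _ _).trans_lt hNK
    nlinarith [h.one_le_R]
  have hNK2 := (le_max_right _ _).trans_lt hNK
  set G : Set ℝ := {x | p x = 1}
  have hG : MeasurableSet G := h.measurableSet_low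
  have hGv : ENNReal.ofReal (c * N) ≤ volume (Set.Icc 0 (N : ℝ) ∩ G) := by
    have := h.le_volume_low (Q := initialCube N hN) (by rwa [initialCube_len]) subset_rfl (by
      calc ENNReal.ofReal δ * volume (initialCube N hN).set
          ≤ 1 * volume (initialCube N hN).set := by
            gcongr; exact ENNReal.ofReal_le_one.2 h.δ_lt.le
        _ = _ := one_mul _)
    rwa [initialCube_len] at this
  have hg := h.assocNorm_low_le (E := G) subset_rfl
  have h1 := hC (chi G) (measurable_const.indicator hG).aemeasurable
    (hg.trans_lt (by norm_num))
  set f : ℝ → ℝ := fun x => chi (highPart p N) x / √N with hf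
  have hfm : AEMeasurable f volume :=
    ((measurable_const.indicator (h.measurableSet_highPart N)).div_const _).aemeasurable
  have hf1 : luxNorm p f ≤ 1 := by
    rw [← ENNReal.ofReal_one]
    refine luxNorm_le one_pos ?_
    simpa only [div_one] using h.modular_highPart_le hN
  have h2 : ∫⁻ x, ‖f x‖ₑ * maximal (chi G) x ≤ assocNorm p (maximal (chi G)) :=
    le_iSup_of_le f (le_iSup₂_of_le hfm hf1 le_rfl)
  have h3 : ENNReal.ofReal (c * ε * √N) ≤ ∫⁻ x, ‖f x‖ₑ * maximal (chi G) x := by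
    calc ENNReal.ofReal (c * ε * √N)
        = ENNReal.ofReal ((√N)⁻¹ * c) * ENNReal.ofReal (ε * N) := by
          rw [← ENNReal.ofReal_mul (by positivity)]
          congr 1
          field_simp
          linarith
      _ ≤ ENNReal.ofReal ((√N)⁻¹ * c) * volume (highPart p N) := by
          gcongr
          exact h.high N
      _ = ∫⁻ x in highPart p N, ENNReal.ofReal ((√N)⁻¹ * c) := by simp
      _ ≤ ∫⁻ x in highPart p N, ‖f x‖ₑ * maximal (chi G) x := by
          refine setLIntegral_mono' (h.measurableSet_highPart N) fun x hx => ?_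
          rw [ENNReal.ofReal_mul (by positivity)]
          gcongr
          · simp [hf, chi, hx, Real.enorm_eq_ofReal_abs, abs_of_pos hr]
          · exact le_maximal_chi hG hN hGv hx.1
      _ ≤ _ := setLIntegral_le_lintegral _ _
  have h4 : ENNReal.ofReal (c * ε * √N) ≤ ENNReal.ofReal (C * 2) := by
    refine h3.trans (h2.trans (h1.trans ?_))
    rw [ENNReal.ofReal_mul C.coe_nonneg, ENNReal.ofReal_coe_nnreal, ENNReal.ofReal_ofNat]
    gcongr
  rw [ENNReal.ofReal_le_ofReal_iff (by positivity)] at h4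
  rw [div_lt_iff₀ (by positivity)] at hNK2
  linarith

end OscillatingExponent

/-! ### Periodic sets and functions -/

lemma measureReal_periodic {S : Set ℝ} (hS : MeasurableSet S) (hper : ∀ x, x + 1 ∈ S ↔ x ∈ S)
    (a : ℝ) (n : ℕ) :
    volume.real (Set.Ioc a (a + n) ∩ S) = n * volume.real (Set.Ioc (-(1 / 2)) (1 / 2) ∩ S) := by
  set φ : ℝ → ℝ := S.indicator 1 with hφ
  have hφper : Function.Periodic φ 1 := fun x => by
    by_cases hx : x ∈ S <;> simp [hφ, hx, hper]
  have hint : ∀ s t : ℝ, IntervalIntegrable φ volume s t := fun s t =>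
    ⟨(integrableOn_const (by simp)).indicator hS, (integrableOn_const (by simp)).indicator hS⟩
  have hval : ∀ s t : ℝ, s ≤ t → ∫ x in s..t, φ x = volume.real (Set.Ioc s t ∩ S) := by
    intro s t hst
    rw [intervalIntegral.integral_of_le hst, hφ, integral_indicator_one hS,
      measureReal_restrict_apply hS,
      Set.inter_comm]
  have h1 := hφper.intervalIntegral_add_zsmul_eq n a hint
  have h2 := hφper.intervalIntegral_add_eq a (-(1 / 2))
  rw [h2] at h1
  have e : (-(1 / 2) : ℝ) + 1 = 1 / 2 := by norm_num
  rw [e] at h1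
  simp only [natCast_zsmul, nsmul_eq_mul, mul_one] at h1
  rwa [hval _ _ (by simp), hval _ _ (by norm_num)] at h1

lemma exists_lipschitz_of_periodic {p : ℝ → ℝ} (hp : ContDiff ℝ 1 p)
    (hper : Function.Periodic p 1) : ∃ H : ℝ, 0 ≤ H ∧ ∀ x y, |p x - p y| ≤ H * |x - y| := by
  have hd : Continuous (deriv p) := hp.continuous_deriv le_rfl
  have hdper : Function.Periodic (deriv p) 1 := fun x => by
    rw [← deriv_comp_add_const, funext hper]
  obtain ⟨H, hH⟩ := isCompact_Icc.exists_bound_of_continuousOn (s := Set.Icc (0 : ℝ) 1)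
    hd.continuousOn
  have hbound : ∀ x, ‖deriv p x‖ ≤ H := fun x => by
    obtain ⟨y, hy, hxy⟩ := hdper.exists_mem_Ico₀ one_pos x
    rw [hxy]
    exact hH y (Set.Ico_subset_Icc_self hy)
  refine ⟨H, (norm_nonneg _).trans (hbound 0), fun x y => ?_⟩
  exact convex_univ.norm_image_sub_le_of_norm_deriv_le
    (fun z _ => (hp.differentiable one_ne_zero).differentiableAt) (fun z _ => hbound z)
    (Set.mem_univ y) (Set.mem_univ x)

/-! ### A periodic oscillating exponent -/

/-- A smooth exponent of period one that equals `2` for `|x| ≤ ε / 2` and `1` for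
`θ / 2 ≤ |x| ≤ 1 / 2`. -/
noncomputable def cosExponent (ε θ x : ℝ) : ℝ :=
  1 + Real.smoothTransition ((Real.cos (2 * Real.pi * x) - Real.cos (Real.pi * θ))
    / (Real.cos (Real.pi * ε) - Real.cos (Real.pi * θ)))

lemma contDiff_cosExponent (ε θ : ℝ) {n : ℕ∞} : ContDiff ℝ n (cosExponent ε θ) := by
  unfold cosExponent
  refine contDiff_const.add (Real.smoothTransition.contDiff.comp ?_)
  exact ((Real.contDiff_cos.comp (contDiff_const.mul contDiff_id)).sub contDiff_const).div_const _

lemma one_le_cosExponent (ε θ x : ℝ) : 1 ≤ cosExponent ε θ x :=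
  le_add_of_nonneg_right (Real.smoothTransition.nonneg _)

lemma cosExponent_le_two (ε θ x : ℝ) : cosExponent ε θ x ≤ 2 := by
  have := Real.smoothTransition.le_one ((Real.cos (2 * Real.pi * x) - Real.cos (Real.pi * θ))
    / (Real.cos (Real.pi * ε) - Real.cos (Real.pi * θ)))
  rw [cosExponent]
  linarith

lemma periodic_cosExponent (ε θ : ℝ) : Function.Periodic (cosExponent ε θ) 1 := fun x => by
  rw [cosExponent, cosExponent, mul_add, mul_one, Real.cos_add_two_pi]

lemma isSmoothBoundedExponent_cosExponent (ε θ : ℝ) :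
    IsSmoothBoundedExponent (cosExponent ε θ) :=
  ⟨contDiff_cosExponent ε θ, one_le_cosExponent ε θ, 2, cosExponent_le_two ε θ⟩

section

variable {ε θ : ℝ}

lemma cos_pi_mul_lt (hε : 0 < ε) (hεθ : ε < θ) (hθ : θ < 1) :
    Real.cos (Real.pi * θ) < Real.cos (Real.pi * ε) := by
  have hπ := Real.pi_pos
  exact Real.cos_lt_cos_of_nonneg_of_le_pi (by positivity) (by nlinarith) (by gcongr)

lemma cos_two_pi_mul_abs (x : ℝ) : Real.cos (2 * Real.pi * x) = Real.cos (Real.pi * (2 * |x|)) := by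
  rw [← Real.cos_abs, abs_mul, abs_of_pos Real.two_pi_pos]
  congr 1
  ring

lemma cosExponent_eq_two (hε : 0 < ε) (hεθ : ε < θ) (hθ : θ < 1) {x : ℝ} (hx : |x| ≤ ε / 2) :
    cosExponent ε θ x = 2 := by
  have hπ := Real.pi_pos
  have h1 : Real.cos (Real.pi * ε) ≤ Real.cos (2 * Real.pi * x) := by
    rw [cos_two_pi_mul_abs]
    exact Real.cos_le_cos_of_nonneg_of_le_pi (by positivity) (by nlinarith)
      (by gcongr; linarith)
  have h2 := sub_pos.2 (cos_pi_mul_lt hε hεθ hθ)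
  rw [cosExponent, Real.smoothTransition.one_of_one_le]
  · norm_num
  · rw [one_le_div h2]
    linarith

lemma cosExponent_eq_one (hε : 0 < ε) (hεθ : ε < θ) (hθ : θ < 1) {x : ℝ} (hx : θ / 2 ≤ |x|)
    (hx1 : |x| ≤ 1 / 2) : cosExponent ε θ x = 1 := by
  have hπ := Real.pi_pos
  have h1 : Real.cos (2 * Real.pi * x) ≤ Real.cos (Real.pi * θ) := by
    rw [cos_two_pi_mul_abs]
    exact Real.cos_le_cos_of_nonneg_of_le_pi (mul_nonneg hπ.le (by linarith)) (by nlinarith)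
      (by gcongr; linarith)
  have h2 := sub_pos.2 (cos_pi_mul_lt hε hεθ hθ)
  rw [cosExponent, Real.smoothTransition.zero_of_nonpos, add_zero]
  exact div_nonpos_of_nonpos_of_nonneg (by linarith) h2.le

end

theorem exists_oscillatingExponent {ε δ : ℝ} (hε : 0 < ε) (hεδ : ε < δ) (hδ : δ < 1) :
    ∃ p : ℝ → ℝ, IsSmoothBoundedExponent p ∧ ∃ H R c, OscillatingExponent p ε δ H R c := by
  set θ := (ε + δ) / 2 with hθ
  have hεθ : ε < θ := by linarith
  have hθδ : θ < δ := by linarith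
  have hθ1 : θ < 1 := by linarith
  set p := cosExponent ε θ with hp
  obtain ⟨H, hH0, hH⟩ := exists_lipschitz_of_periodic (contDiff_cosExponent ε θ (n := 1))
    (periodic_cosExponent ε θ)
  have hcont : Continuous p := (contDiff_cosExponent ε θ (n := 1)).continuous
  have hmeas : ∀ a, MeasurableSet {x | p x = a} := fun a =>
    measurableSet_eq_fun hcont.measurable measurable_const
  have hper := periodic_cosExponent ε θ
  set c := (δ - θ) / 2 with hc
  have hc0 : 0 < c := by rw [hc]; linarith
  -- With `δ - c = θ + c`, the bound `(L + 2) * θ ≤ (δ - c) * L` needs exactly `L ≥ 2 * θ / c`; this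
  -- dictates `R`.
  refine ⟨p, isSmoothBoundedExponent_cosExponent ε θ, H, max 1 (2 * θ / c), c, ?_⟩
  refine ⟨hcont, one_le_cosExponent ε θ, cosExponent_le_two ε θ, hH, hH0, le_max_left _ _,
    hc0, hε, by linarith, hδ, fun N => ?_, fun Q hQ => ?_⟩
  · have h1 := measureReal_periodic (hmeas 2) (fun x => by simp only [Set.mem_ofPred_eq, hp, hper x])
      0 N
    have h2 : ε ≤ volume.real (Set.Ioc (-(1 / 2)) (1 / 2) ∩ {x | p x = 2}) := by
      have h3 : volume.real (Set.Ioc (-(ε / 2)) (ε / 2)) = ε := by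
        rw [Real.volume_real_Ioc_of_le (by linarith)]
        ring
      rw [← h3]
      refine measureReal_mono (fun x hx => ⟨⟨by linarith [hx.1], by linarith [hx.2]⟩, ?_⟩)
        (measure_ne_top_of_subset Set.inter_subset_left (by simp))
      exact cosExponent_eq_two hε hεθ hθ1 (abs_le.2 ⟨hx.1.le, hx.2⟩)
    rw [zero_add] at h1
    calc ENNReal.ofReal (ε * N)
        ≤ ENNReal.ofReal (volume.real (Set.Ioc 0 (N : ℝ) ∩ {x | p x = 2})) := by
          rw [h1, mul_comm]
          gcongr
      _ = volume (Set.Ioc 0 (N : ℝ) ∩ {x | p x = 2}) :=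
          ENNReal.ofReal_toReal (measure_ne_top_of_subset Set.inter_subset_left (by simp))
      _ ≤ _ := by
          gcongr
          exact Set.Ioc_subset_Icc_self
  · have hL := Q.len_pos
    -- The covering union of `n` periods starts at `Q.left - 1`, because half-open intervals omit
    -- their left endpoint; the excess length is at most `2`.
    set n := ⌈Q.len⌉₊ + 1 with hn
    have hn1 : Q.len + 1 ≤ n := by
      have := Nat.le_ceil Q.len
      push_cast [hn]
      linarith
    have hn2 : (n : ℝ) ≤ Q.len + 2 := by
      have := Nat.ceil_lt_add_one hL.le
      push_cast [hn]
      linarith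
    have h1 := measureReal_periodic (hmeas 1).compl
      (fun x => by simp only [Set.mem_compl_iff, Set.mem_ofPred_eq, hp, hper x]) (Q.left - 1) n
    have h2 : volume.real (Set.Ioc (-(1 / 2)) (1 / 2) ∩ {x | p x = 1}ᶜ) ≤ θ := by
      have h3 : volume.real (Set.Icc (-(θ / 2)) (θ / 2)) = θ := by
        rw [Real.volume_real_Icc_of_le (by linarith)]
        ring
      rw [← h3]
      refine measureReal_mono (fun x hx => ?_) (by simp)
      by_contra hxθ
      refine hx.2 (cosExponent_eq_one hε hεθ hθ1 ?_ (abs_le.2 ⟨hx.1.1.le, hx.1.2⟩))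
      by_contra! hlt
      exact hxθ (abs_le.1 hlt.le)
    have hsub : Q.set \ {x | p x = 1} ⊆ Set.Ioc (Q.left - 1) (Q.left - 1 + n) ∩ {x | p x = 1}ᶜ := by
      refine fun x hx => ⟨⟨by linarith [hx.1.1], ?_⟩, hx.2⟩
      have := hx.1.2
      rw [Cube.len] at hn1
      linarith
    calc volume (Q.set \ {x | p x = 1})
        ≤ volume (Set.Ioc (Q.left - 1) (Q.left - 1 + n) ∩ {x | p x = 1}ᶜ) := measure_mono hsub
      _ = ENNReal.ofReal (n * volume.real (Set.Ioc (-(1 / 2)) (1 / 2) ∩ {x | p x = 1}ᶜ)) := by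
          rw [← h1]
          exact (ENNReal.ofReal_toReal
            (measure_ne_top_of_subset Set.inter_subset_left (by simp))).symm
      _ ≤ ENNReal.ofReal ((Q.len + 2) * θ) := by gcongr
      _ ≤ ENNReal.ofReal ((δ - c) * Q.len) := by
          refine ENNReal.ofReal_le_ofReal ?_
          have h4 := (le_max_right _ _).trans hQ
          rw [div_le_iff₀ hc0] at h4
          have h5 : δ - c = θ + c := by rw [hc]; ring
          rw [h5]
          linarith

end VarExpBMO

theorem mainTheorem10 :
    (∀ ε δ : ℝ, 0 < ε → ε < δ → δ < 1 →
      ∃ p : ℝ → ℝ, VarExpBMO.IsSmoothBoundedExponent p ∧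
        (VarExpBMO.CondA δ (VarExpBMO.varLp p) ∧ ¬ VarExpBMO.CondA ε (VarExpBMO.varLp p)) ∧
        (∃ C : ℝ≥0, ∀ t : ℝ, 0 < t → t < 1 →
          VarExpBMO.psi (VarExpBMO.varLp p) t ≤ C * ENNReal.ofReal (t ^ (1 / 2 : ℝ))) ∧
        (VarExpBMO.BMOXStar (VarExpBMO.varLp p)).Embeds VarExpBMO.BMO ∧
        VarExpBMO.BMO.Same (VarExpBMO.BMOX (VarExpBMO.varLp p)) ∧
        (VarExpBMO.BMOX (VarExpBMO.varLp p)).Same (VarExpBMO.BMOXStar (VarExpBMO.varLp p)) ∧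
        ¬ VarExpBMO.MaximalRestrictedWeakType p ∧
        ¬ VarExpBMO.MaximalBoundedOnAssociate p) ∧
    (∀ η : ℝ, 0 < η → η < 1 →
      ∃ p : ℝ → ℝ, VarExpBMO.IsSmoothBoundedExponent p ∧
        VarExpBMO.BMO.Same (VarExpBMO.BMOX (VarExpBMO.varLp p)) ∧
        (VarExpBMO.BMOX (VarExpBMO.varLp p)).Same (VarExpBMO.BMOXStar (VarExpBMO.varLp p)) ∧
        ¬ VarExpBMO.CondA η (VarExpBMO.varLp p) ∧
        ¬ VarExpBMO.MaximalRestrictedWeakType p ∧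
        ¬ VarExpBMO.MaximalBoundedOnAssociate p) := by

  refine ⟨fun ε δ hε hεδ hδ => ?_, fun η hη hη1 => ?_⟩
  · obtain ⟨p, hp, H, R, c, h⟩ := VarExpBMO.exists_oscillatingExponent hε hεδ hδ
    exact ⟨p, hp, ⟨h.condA, h.not_condA⟩, h.psi_le, h.bmoXStar_embeds_bmo, h.bmo_same_bmoX,
      h.bmoX_same_bmoXStar, h.not_restrictedWeakType, h.not_maximalBoundedOnAssociate⟩
  -- Here `η` plays the role of `ε`, and any `δ` strictly between `η` and `1` would do; the midpoint
  -- is chosen.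
  · obtain ⟨p, hp, H, R, c, h⟩ := VarExpBMO.exists_oscillatingExponent hη
      (show η < (η + 1) / 2 by linarith) (by linarith)
    exact ⟨p, hp, h.bmo_same_bmoX, h.bmoX_same_bmoXStar, h.not_condA, h.not_restrictedWeakType,
      h.not_maximalBoundedOnAssociate⟩
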